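/- Let $X$ be a $\sigma$-compact metric space with its Borel $\sigma$-algebra and let $\sigma$ be a $\sigma$-finite diffuse measure on $X$ that is finite on compact sets. Let $\Omega^X$ be the space of at most countable, locally finite subsets $\omega$ of $X$, each identified with the point measure $\sum_{x\in\omega}\epsilon_x$ ($\epsilon_x$ the Dirac measure at $x$), with the $\sigma$-algebra generated by the maps $\omega\mapsto\omega(A)$, $A\subset X$ Borel. Let $E$ denote expectation under the Poisson probability measure $\pi_\sigma$ with intensity $\sigma$ on $\Omega^X$, i.e. for all pairwise disjoint compact sets $A_1,\dots,A_m\subset X$ the variables $\omega(A_1),\dots,\omega(A_m)$ are independent and Poisson distributed with parameters $\sigma(A_1),\dots,\sigma(A_m)$. Let $F:\Omega^X\to\mathbb R$ be a bounded random variable and let $u:\Omega^X\times X\to\mathbb R$, $(\omega,x)\mapsto u_x(\omega)$, be a bounded (jointly measurable) process with compact support in $X$, i.e. there is a compact $K\subset X$ with $u_x(\omega)=0$ for all $\omega\in\Omega^X$ and $x\in X\setminus K$. Put $$\delta(u)(\omega)=\int_X u_x(\omega\setminus\{x\})\,\omega(dx)-\int_X u_x(\omega)\,\sigma(dx).$$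 For points $s_1,\dots,s_k\in X$ write $\mathfrak s_k=(s_1,\dots,s_k)$ and $\varepsilon^+_{\mathfrak s_k}G(\omega)=G(\omega\cup\{s_1,\dots,s_k\})$ for $G:\Omega^X\to\mathbb R$; let $\mathfrak s_k\setminus s_p$ be $\mathfrak s_k$ with the entry of index $p$ removed if $p\le k$, and $\mathfrak s_k\setminus s_p=\mathfrak s_k$ if $p>k$. For integers $l_1,\dots,l_k\ge1$ let $\mathcal N_{(l_1,\dots,l_k)}$ be the number of partitions of the set $\{1,\dots,l_1+\cdots+l_k\}$ into $k$ blocks which, when listed in increasing order of their largest elements, have cardinalities $l_1,\dots,l_k$ in this order. Then for all $n\ge0$ $$ E\left[\delta(u)^nF\right]=\sum_{c=0}^n(-1)^c\binom nc\sum_{k=0}^{n-c}\ \sum_{\substack{l_1+\cdots+l_k=n-c\\ l_1,\dots,l_k\ge1}}\mathcal N_{(l_1,\dots,l_k)}\;E\left[\int_{X^{k+c}}\varepsilon^+_{\mathfrak s_k}F\ \prod_{p=1}^{k+c}\varepsilon^+_{\mathfrak s_k\setminus s_p}\big(u_{s_p}^{l_p}\big)\,\sigma(ds_1)\cdots\sigma(ds_{k+c})\right],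 $$ where $l_{k+1}=\cdots=l_{k+c}=1$; moreover $\delta(u)^nF$ is $\pi_\sigma$-integrable and each integrand on the right is integrable with respect to $\pi_\sigma\otimes\sigma^{\otimes(k+c)}$. -/

import Mathlib

open MeasureTheory ProbabilityTheory

noncomputable section

/-- A configuration on `X`: an at most countable, locally finite set of pairwise distinct points.
In a metric space a set is locally finite (every point has a neighbourhood meeting it in a finite
set) if and only if it meets every compact set in a finite set. -/
@[ext]
structure Configuration (X : Type*) [TopologicalSpace X] where
  /-- The points of the configuration. -/
  points : Set X
  countable : points.Countable
  finite_inter : ∀ K : Set X, IsCompact K → (points ∩ K).Finite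

namespace Configuration

variable {X : Type*} [TopologicalSpace X]

/-- The configuration `ω ∪ {s i | i}`, for a finite family of points `s`. -/
def addPoints {ι : Type*} [Finite ι] (s : ι → X) (ω : Configuration X) : Configuration X where
  points := ω.points ∪ Set.range s
  countable := ω.countable.union (Set.finite_range s).countable
  finite_inter K hK := by
    rw [Set.union_inter_distrib_right]
    exact (ω.finite_inter K hK).union ((Set.finite_range s).subset Set.inter_subset_left)

/-- The configuration `ω \ {x}`. -/
def erase (x : X) (ω : Configuration X) : Configuration X where
  points := ω.points \ {x}
  countable := ω.countable.mono Set.sdiff_subset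
  finite_inter K hK := (ω.finite_inter K hK).subset (Set.inter_subset_inter_left K Set.sdiff_subset)

/-- The point measure `∑ x ∈ ω, ε_x` with which a configuration `ω` is identified. -/
def toMeasure [MeasurableSpace X] (ω : Configuration X) : Measure X :=
  Measure.sum fun x : ω.points => Measure.dirac (x : X)

/-- The σ-algebra on the configuration space generated by the maps `ω ↦ ω(A)`, `A` measurable. -/
instance instMeasurableSpace [MeasurableSpace X] : MeasurableSpace (Configuration X) :=
  MeasurableSpace.comap toMeasure inferInstance

/-- The operator `ε⁺` of addition of the points `s i`: `(ε⁺_s G)(ω) = G (ω ∪ {s i | i})`. -/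
def epsPlus {ι : Type*} [Finite ι] (s : ι → X) (G : Configuration X → ℝ) :
    Configuration X → ℝ :=
  fun ω => G (ω.addPoints s)

end Configuration

/-- `π` is the Poisson probability measure with intensity `σ` on the configuration space: for all
pairwise disjoint compact sets `A 1, …, A n`, the counts `ω (A 1), …, ω (A n)` are independent
Poisson random variables with parameters `σ (A 1), …, σ (A n)`. (The intensity is meant to be
finite on compact sets.) -/
structure IsPoissonLaw {X : Type*} [TopologicalSpace X] [MeasurableSpace X]
    (σ : Measure X) (π : Measure (Configuration X)) : Prop where
  isProbabilityMeasure : IsProbabilityMeasure π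
  iIndepFun_count : ∀ (n : ℕ) (A : Fin n → Set X), (∀ i, IsCompact (A i)) →
    Pairwise (fun i j => Disjoint (A i) (A j)) →
    iIndepFun (fun (i : Fin n) (ω : Configuration X) => ω.toMeasure (A i)) π
  map_count : ∀ A : Set X, IsCompact A →
    π.map (fun ω : Configuration X => ω.toMeasure A) =
      (poissonMeasure (σ A).toNNReal).map (fun m : ℕ => (m : ENNReal))

/-- The compensated Poisson–Skorohod integral
`δ(u)(ω) = ∫ u_x(ω \ x) ω(dx) - ∫ u_x(ω) σ(dx)`. -/
def skorohod {X : Type*} [TopologicalSpace X] [MeasurableSpace X] (σ : Measure X)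
    (u : Configuration X → X → ℝ) (ω : Configuration X) : ℝ :=
  (∫ x, u (ω.erase x) x ∂ω.toMeasure) - ∫ x, u ω x ∂σ

/-- The number of partitions of a set of `l_1 + ⋯ + l_k` elements into `k` subsets of sizes
`l_1, …, l_k`. Each set partition is counted for exactly one tuple of sizes, namely the sizes of
its blocks listed by increasing greatest element, which is how `OrderedFinpartition` presents
a set partition. -/
def numSetPartitions {k : ℕ} (l : Fin k → ℕ) : ℕ :=
  Nat.card {P : OrderedFinpartition (∑ i, l i) //
    ∃ h : P.length = k, ∀ i : Fin k, P.partSize (Fin.cast h.symm i) = l i}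

/-- The integrand
`(ε⁺_{(s_1,…,s_k)} F)(ω) * ∏_{p=1}^{k+c} (ε⁺_{(s_1,…,s_k) \ s_p} u_{s_p}^{l_p})(ω)`, where
`l_{k+1} = ⋯ = l_{k+c} = 1`. In the `p`-th factor the entry of index `p` is removed from
`(s_1,…,s_k)`; nothing is removed when `p > k`. -/
def momentIntegrand {X : Type*} [TopologicalSpace X]
    (F : Configuration X → ℝ) (u : Configuration X → X → ℝ) {k : ℕ} (l : Fin k → ℕ) (c : ℕ)
    (ω : Configuration X) (s : Fin (k + c) → X) : ℝ :=
  Configuration.epsPlus (fun j : Fin k => s (Fin.castAdd c j)) F ω *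
    ∏ p : Fin (k + c),
      Configuration.epsPlus
        (fun j : {j : Fin k // Fin.castAdd c j ≠ p} => s (Fin.castAdd c (j : Fin k)))
        (fun η => u η (s p) ^ (Fin.append l (fun _ : Fin c => 1) p)) ω

end

/-! The engine is the Mecke formula: for compact `K`, the expectation of the sum of `h (ω \ x, x)`
over the points `x` of `ω` in `K` equals the expectation of the integral of `h (ω, x)` over `K`
against `σ`. For a single count it is the recursion `(n + 1) P(N = n + 1) = λ P(N = n)` of the
Poisson weights. Independence carries it to several disjoint compact sets, approximation from inside
to disjoint Borel sets (`succ_mul_measure`), atoms to arbitrary finite families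
(`lintegral_sum_count_erase`), and a π-system argument to the measure identity `map_erase_compProd`.
Iteration gives the version for tuples of distinct points, `integral_injSum`.

Let `K` support `u`, and expand `δ(u)^n` by the binomial theorem, with `c` the number of compensator
factors. The power `n - c` of the remaining finite sum over points expands according to which
indices coincide, that is, over set partitions (`sum_pow_eq_sum_injSum`). If `x` is a tuple of
distinct points of `ω` and `η = ω \ x`, then `ω = η ∪ x` and `ω \ x_i = η ∪ {x_j : j ≠ i}`, so each
term depends on `(η, x)` only and the Mecke formula for tuples applies. By Fubini, the `c`-th power
of the compensator becomes `c` further integration variables, and grouping partitions by their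
ordered block sizes produces the coefficients (`sum_orderedFinpartition_eq`). Integrability reduces
to boundedness and the finiteness of all moments of `ω(K)`, which also follows from the Mecke
formula. -/

namespace Configuration

/-! ### Configurations, their traces on compact sets, adding and erasing points -/

section Basic

variable {X : Type*} [TopologicalSpace X]

/-- The points of a configuration in a compact set. -/
noncomputable def pts {K : Set X} (hK : IsCompact K) (ω : Configuration X) : Finset X :=
  (ω.finite_inter K hK).toFinset

@[simp]
lemma mem_pts {K : Set X} (hK : IsCompact K) (ω : Configuration X) (x : X) :
    x ∈ ω.pts hK ↔ x ∈ ω.points ∧ x ∈ K := by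
  simp [pts]

lemma coe_pts {K : Set X} (hK : IsCompact K) (ω : Configuration X) :
    (ω.pts hK : Set X) = ω.points ∩ K := by
  simp [pts]

@[simp]
lemma points_erase (x : X) (ω : Configuration X) : (ω.erase x).points = ω.points \ {x} := rfl

lemma pts_erase [DecidableEq X] {K : Set X} (hK : IsCompact K) (ω : Configuration X) (x : X) :
    (ω.erase x).pts hK = (ω.pts hK).erase x := by
  ext y
  simp only [mem_pts, points_erase, Set.mem_sdiff, Set.mem_singleton_iff, Finset.mem_erase]
  tauto

/-- The number of points of a configuration in a set (`0` if there are infinitely many). -/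
noncomputable def count (A : Set X) (ω : Configuration X) : ℕ := (ω.points ∩ A).ncard

lemma count_eq_card {K : Set X} (hK : IsCompact K) (ω : Configuration X) :
    ω.count K = (ω.pts hK).card := by
  rw [count, ← coe_pts hK, Set.ncard_coe_finset]

lemma finite_inter_of_subset {A K : Set X} (hK : IsCompact K) (hA : A ⊆ K)
    (ω : Configuration X) : (ω.points ∩ A).Finite :=
  (ω.finite_inter K hK).subset (Set.inter_subset_inter_right _ hA)

/-- The configuration `ω ∪ {x}`. -/
def insertPoint (x : X) (ω : Configuration X) : Configuration X :=
  ω.addPoints fun _ : Unit => x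

@[simp]
lemma points_insertPoint (x : X) (ω : Configuration X) :
    (ω.insertPoint x).points = insert x ω.points := by
  simp [insertPoint, addPoints]

@[simp]
lemma points_addPoints {ι : Type*} [Finite ι] (s : ι → X) (ω : Configuration X) :
    (ω.addPoints s).points = ω.points ∪ Set.range s := rfl

lemma addPoints_succ {k : ℕ} (s : Fin (k + 1) → X) (ω : Configuration X) :
    ω.addPoints s = (ω.addPoints (Fin.tail s)).insertPoint (s 0) := by
  ext y
  simp only [points_addPoints, points_insertPoint, Set.mem_union, Set.mem_range, Set.mem_insert_iff,
    Fin.exists_fin_succ, Fin.tail, eq_comm (a := y)]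
  tauto

lemma addPoints_zero (s : Fin 0 → X) (ω : Configuration X) : ω.addPoints s = ω := by
  ext y
  simp

lemma addPoints_comp_equiv {ι κ : Type*} [Finite ι] [Finite κ] (e : κ ≃ ι) (s : ι → X)
    (ω : Configuration X) : ω.addPoints (s ∘ e) = ω.addPoints s := by
  ext y
  simp [e.surjective.range_comp]

/-- The configuration `ω \ {s i | i}`. -/
def erasePoints {ι : Type*} (s : ι → X) (ω : Configuration X) : Configuration X where
  points := ω.points \ Set.range s
  countable := ω.countable.mono Set.sdiff_subset
  finite_inter K hK := (ω.finite_inter K hK).subset (Set.inter_subset_inter_left K Set.sdiff_subset)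

@[simp]
lemma points_erasePoints {ι : Type*} (s : ι → X) (ω : Configuration X) :
    (ω.erasePoints s).points = ω.points \ Set.range s := rfl

lemma erasePoints_zero (s : Fin 0 → X) (ω : Configuration X) : ω.erasePoints s = ω := by
  ext y
  simp

lemma erasePoints_cons {k : ℕ} (y : X) (s : Fin k → X) (ω : Configuration X) :
    ω.erasePoints (Fin.cons y s : Fin (k + 1) → X) = (ω.erase y).erasePoints s := by
  ext z
  simp only [points_erasePoints, points_erase, Set.mem_sdiff, Fin.range_cons, Set.mem_insert_iff,
    Set.mem_singleton_iff]
  tauto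

end Basic

/-! ### Point measures, counts and the kernel of points in a compact set -/

section Measure

variable {X : Type*} [TopologicalSpace X] [MeasurableSpace X]

lemma toMeasure_apply (ω : Configuration X) {A : Set X} (hA : MeasurableSet A) :
    ω.toMeasure A = ((ω.points ∩ A).encard : ENNReal) := by
  classical
  rw [toMeasure, Measure.sum_apply _ hA, ← ENNReal.tsum_set_one,
    tsum_subtype (ω.points) (fun x => Measure.dirac x A),
    tsum_subtype (ω.points ∩ A) (fun _ => (1 : ENNReal))]
  congr 1 with x
  by_cases h : x ∈ ω.points <;> by_cases h' : x ∈ A <;> simp [h, h', hA]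

lemma toMeasure_eq_count (ω : Configuration X) {A K : Set X} (hA : MeasurableSet A)
    (hK : IsCompact K) (h : A ⊆ K) : ω.toMeasure A = (ω.count A : ENNReal) := by
  rw [toMeasure_apply _ hA, ← (finite_inter_of_subset hK h ω).cast_ncard_eq]
  simp [count]

lemma measurable_toMeasure : Measurable (toMeasure : Configuration X → Measure X) :=
  comap_measurable _

lemma measurable_toMeasure_apply {A : Set X} (hA : MeasurableSet A) :
    Measurable fun ω : Configuration X => ω.toMeasure A :=
  (Measure.measurable_coe hA).comp measurable_toMeasure

lemma measurable_iff_toMeasure {β : Type*} [MeasurableSpace β] {f : β → Configuration X} :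
    Measurable f ↔ ∀ A, MeasurableSet A → Measurable fun b => (f b).toMeasure A := by
  rw [measurable_comap_iff]
  exact ⟨fun h A hA => (Measure.measurable_coe hA).comp h,
    fun h => Measure.measurable_of_measurable_coe _ h⟩

lemma measurable_count {A K : Set X} (hA : MeasurableSet A) (hK : IsCompact K) (h : A ⊆ K) :
    Measurable (count A : Configuration X → ℕ) := by
  have : (count A : Configuration X → ℕ) = fun ω => ⌊(ω.toMeasure A).toReal⌋₊ := by
    ext ω
    simp [toMeasure_eq_count ω hA hK h]
  rw [this]
  exact Nat.measurable_floor.comp (measurable_toMeasure_apply hA).ennreal_toReal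

lemma toMeasure_restrict (ω : Configuration X) {K : Set X} (hK : IsCompact K)
    (hKm : MeasurableSet K) :
    ω.toMeasure.restrict K = ∑ x ∈ ω.pts hK, Measure.dirac x := by
  classical
  ext A hA
  rw [Measure.restrict_apply hA, toMeasure_eq_count ω (hA.inter hKm) hK Set.inter_subset_right,
    Measure.finsetSum_apply]
  simp only [Measure.dirac_apply' _ hA, Set.indicator_apply, Pi.one_apply]
  rw [Finset.sum_ite, Finset.sum_const, Finset.sum_const_zero, add_zero, count, nsmul_one,
    ← Set.ncard_coe_finset]
  congr 3
  ext x
  simp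
  tauto

lemma integral_toMeasure_restrict [MeasurableSingletonClass X] (ω : Configuration X)
    {K : Set X} (hK : IsCompact K) (hKm : MeasurableSet K) (f : X → ℝ) :
    ∫ x in K, f x ∂ω.toMeasure = ∑ x ∈ ω.pts hK, f x := by
  rw [toMeasure_restrict ω hK hKm, integral_finsetSum_measure]
  · simp
  · intro i _
    exact integrable_dirac (by simp)

lemma lintegral_toMeasure_restrict [MeasurableSingletonClass X] (ω : Configuration X)
    {K : Set X} (hK : IsCompact K) (hKm : MeasurableSet K) (f : X → ENNReal) :
    ∫⁻ x in K, f x ∂ω.toMeasure = ∑ x ∈ ω.pts hK, f x := by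
  rw [toMeasure_restrict ω hK hKm, lintegral_finsetSum_measure]
  simp

/-- The kernel `ω ↦ ∑ x ∈ ω ∩ K, ε_x`. -/
noncomputable def restrictKernel {K : Set X} (hKm : MeasurableSet K) : Kernel (Configuration X) X :=
  Kernel.restrict ⟨toMeasure, measurable_toMeasure⟩ hKm

@[simp]
lemma restrictKernel_apply {K : Set X} (hKm : MeasurableSet K) (ω : Configuration X) :
    restrictKernel hKm ω = ω.toMeasure.restrict K := by
  simp [restrictKernel, Kernel.restrict_apply]

/-- The number of points in `K` is finite but has no uniform bound, so the kernel is cut along the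
level sets of the count; the `n`-th piece has mass at most `n`. -/
lemma isSFiniteKernel_restrictKernel {K : Set X} (hK : IsCompact K) (hKm : MeasurableSet K) :
    IsSFiniteKernel (restrictKernel hKm) := by
  classical
  have hm (n : ℕ) : MeasurableSet {ω : Configuration X | ω.count K = n} :=
    measurable_count hKm hK subset_rfl (measurableSet_singleton n)
  have : restrictKernel hKm =
      Kernel.sum fun n : ℕ => Kernel.piecewise (hm n) (restrictKernel hKm) 0 := by
    ext ω A hA
    rw [Kernel.sum_apply' _ _ hA, tsum_eq_single (ω.count K)]
    · simp [Kernel.piecewise_apply]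
    · intro n hn
      simp [Kernel.piecewise_apply, hn.symm]
  rw [this]
  have (n : ℕ) : IsFiniteKernel (Kernel.piecewise (hm n) (restrictKernel hKm) 0) := by
    refine ⟨⟨n, by simp, fun ω => ?_⟩⟩
    rw [Kernel.piecewise_apply]
    split_ifs with h
    · rw [restrictKernel_apply, Measure.restrict_apply_univ, toMeasure_eq_count ω hKm hK subset_rfl]
      exact le_of_eq (congrArg _ h)
    · simp
  infer_instance

end Measure

/-! ### Joint measurability of membership, erasure and insertion -/

section Metric

variable {X : Type*} [MetricSpace X]

/-- A convergent sequence together with its limit is compact, hence meets `ω` in a finite, thus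
closed, set. -/
lemma isClosed_points (ω : Configuration X) : IsClosed ω.points := by
  refine IsSeqClosed.isClosed fun x p hx hp => ?_
  have hK := hp.isCompact_insert_range
  have : p ∈ ω.points ∩ insert p (Set.range x) :=
    (ω.finite_inter _ hK).isClosed.mem_of_tendsto hp
      (Filter.Eventually.of_forall fun n => ⟨hx n, Or.inr ⟨n, rfl⟩⟩)
  exact this.1

variable [SigmaCompactSpace X] [MeasurableSpace X] [BorelSpace X]

/-- As `ω` is closed, `x ∉ ω` exactly when some basic open set around `x` is free of points of `ω`.
Second countability makes the complement a countable union of measurable rectangles. -/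
lemma measurableSet_mem_points :
    MeasurableSet {q : Configuration X × X | q.2 ∈ q.1.points} := by
  have := UniformSpace.secondCountable_of_separable X
  let b := TopologicalSpace.countableBasis X
  have hb : TopologicalSpace.IsTopologicalBasis b := TopologicalSpace.isBasis_countableBasis X
  have hbm (B : Set X) (hB : B ∈ b) : MeasurableSet B := (hb.isOpen hB).measurableSet
  have : {q : Configuration X × X | q.2 ∈ q.1.points}ᶜ =
      ⋃ B ∈ b, {q | q.2 ∈ B ∧ q.1.toMeasure B = 0} := by
    ext ⟨ω, x⟩
    simp only [Set.mem_compl_iff, Set.mem_ofPred_eq, Set.mem_iUnion, exists_prop]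
    constructor
    · intro h
      obtain ⟨B, hB, hxB, hBs⟩ := hb.exists_subset_of_mem_open (a := x) (u := ω.pointsᶜ) h
        ω.isClosed_points.isOpen_compl
      refine ⟨B, hB, hxB, ?_⟩
      rw [toMeasure_apply ω (hbm B hB)]
      have : ω.points ∩ B = ∅ :=
        Set.disjoint_iff_inter_eq_empty.1 (Set.disjoint_left.2 fun y hy hyB => hBs hyB hy)
      simp [this]
    · rintro ⟨B, hB, hxB, h0⟩ hx
      rw [toMeasure_apply ω (hbm B hB)] at h0
      have : ω.points ∩ B = ∅ := by simpa using h0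
      exact (this ▸ ⟨hx, hxB⟩ : x ∈ (∅ : Set X))
  refine MeasurableSet.of_compl ?_
  rw [this]
  refine MeasurableSet.biUnion (TopologicalSpace.countable_countableBasis X) fun B hB => ?_
  exact (measurable_snd (hbm B hB)).inter
    (((measurable_toMeasure_apply (hbm B hB)).comp measurable_fst) (measurableSet_singleton 0))

lemma measurable_erase :
    Measurable fun q : Configuration X × X => q.1.erase q.2 := by
  classical
  refine measurable_iff_toMeasure.2 fun A hA => ?_
  have : (fun q : Configuration X × X => (q.1.erase q.2).toMeasure A) = fun q =>
      q.1.toMeasure A - if q.2 ∈ q.1.points ∧ q.2 ∈ A then 1 else 0 := by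
    ext ⟨ω, x⟩
    have h1 : (ω.points \ {x}) ∩ A = (ω.points ∩ A) \ {x} := by ext; simp; tauto
    rw [toMeasure_apply _ hA, toMeasure_apply _ hA, points_erase, h1]
    split_ifs with h
    · rw [← Set.encard_sdiff_singleton_add_one (s := ω.points ∩ A) h]
      simp
    · rw [Set.sdiff_singleton_eq_self (by simpa using h)]
      simp
  rw [this]
  refine ((measurable_toMeasure_apply hA).comp measurable_fst).sub
    (Measurable.ite ?_ measurable_const measurable_const)
  exact measurableSet_mem_points.inter (measurable_snd hA)

lemma measurable_insertPoint :
    Measurable fun q : Configuration X × X => q.1.insertPoint q.2 := by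
  classical
  refine measurable_iff_toMeasure.2 fun A hA => ?_
  have : (fun q : Configuration X × X => (q.1.insertPoint q.2).toMeasure A) = fun q =>
      q.1.toMeasure A + if q.2 ∉ q.1.points ∧ q.2 ∈ A then 1 else 0 := by
    ext ⟨ω, x⟩
    rw [toMeasure_apply _ hA, toMeasure_apply _ hA, points_insertPoint]
    by_cases h2 : x ∈ A
    · rw [Set.insert_inter_of_mem h2]
      by_cases h : x ∈ ω.points
      · rw [Set.insert_eq_of_mem (show x ∈ ω.points ∩ A from ⟨h, h2⟩)]
        simp [h]
      · rw [Set.encard_insert_of_notMem (fun h' : x ∈ ω.points ∩ A => h h'.1)]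
        simp [h, h2]
    · rw [Set.insert_inter_of_notMem h2]
      simp [h2]
  rw [this]
  refine ((measurable_toMeasure_apply hA).comp measurable_fst).add
    (Measurable.ite ?_ measurable_const measurable_const)
  exact measurableSet_mem_points.compl.inter (measurable_snd hA)

lemma measurable_addPoints_fin (k : ℕ) :
    Measurable fun q : Configuration X × (Fin k → X) => q.1.addPoints q.2 := by
  induction k with
  | zero => simpa only [addPoints_zero] using measurable_fst
  | succ k ih =>
    simp only [addPoints_succ]
    refine measurable_insertPoint.comp (Measurable.prodMk (ih.comp (Measurable.prodMk
      measurable_fst ?_)) ?_)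
    · exact measurable_pi_lambda _ fun i => (measurable_pi_apply (Fin.succ i)).comp measurable_snd
    · exact (measurable_pi_apply 0).comp measurable_snd

lemma measurable_addPoints {ι : Type*} [Finite ι] :
    Measurable fun q : Configuration X × (ι → X) => q.1.addPoints q.2 := by
  obtain ⟨n, ⟨e⟩⟩ := Finite.exists_equiv_fin ι
  simp only [← addPoints_comp_equiv e.symm]
  refine (measurable_addPoints_fin n).comp (Measurable.prodMk measurable_fst ?_)
  exact measurable_pi_lambda _ fun i => (measurable_pi_apply _).comp measurable_snd

end Metric

end Configuration

/-! ### The Poisson recursion, from compact sets to disjoint Borel sets -/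

lemma succ_mul_poissonMeasure (r : NNReal) (n : ℕ) :
    ((n + 1 : ℕ) : ENNReal) * poissonMeasure r {n + 1} = r * poissonMeasure r {n} := by
  rw [poissonMeasure_singleton, poissonMeasure_singleton, ← ENNReal.ofReal_natCast,
    ← ENNReal.ofReal_coe_nnreal, ← ENNReal.ofReal_mul (by positivity),
    ← ENNReal.ofReal_mul (by positivity), Nat.factorial_succ]
  congr 1
  push_cast
  field_simp
  ring

lemma lintegral_natCast_poissonMeasure (r : NNReal) :
    ∫⁻ n, (n : ENNReal) ∂(poissonMeasure r) = r := by
  rw [lintegral_countable', tsum_eq_zero_add' ENNReal.summable]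
  simp only [succ_mul_poissonMeasure, ENNReal.tsum_mul_left]
  have : ∑' n, poissonMeasure r {n} = 1 := by
    have h := lintegral_countable' (μ := poissonMeasure r) (fun _ : ℕ => (1 : ENNReal))
    simpa using h.symm
  simp [this]

namespace IsPoissonLaw

open Configuration

variable {X : Type*} [MetricSpace X] [MeasurableSpace X] [BorelSpace X]
  {σ : Measure X} {π : Measure (Configuration X)}

section Compact

variable [IsFiniteMeasureOnCompacts σ]

omit [IsFiniteMeasureOnCompacts σ] in
lemma measure_count_eq (hπ : IsPoissonLaw σ π) {C : Set X} (hC : IsCompact C) (n : ℕ) :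
    π {ω | ω.count C = n} = poissonMeasure (σ C).toNNReal {n} := by
  have h := congrArg (fun μ => μ {(n : ENNReal)}) (hπ.map_count C hC)
  beta_reduce at h
  rw [Measure.map_apply (measurable_toMeasure_apply hC.measurableSet) (measurableSet_singleton _),
    Measure.map_apply .of_discrete (measurableSet_singleton _)] at h
  convert h using 2
  · ext ω
    simp [toMeasure_eq_count ω hC.measurableSet hC subset_rfl]
  · ext m
    simp

omit [IsFiniteMeasureOnCompacts σ] in
lemma measure_forall_count_eq (hπ : IsPoissonLaw σ π) {ι : Type*} [Fintype ι] {C : ι → Set X}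
    (hC : ∀ i, IsCompact (C i)) (hd : Pairwise fun i j => Disjoint (C i) (C j)) (n : ι → ℕ) :
    π {ω | ∀ i, ω.count (C i) = n i} = ∏ i, π {ω | ω.count (C i) = n i} := by
  let e := (Fintype.equivFin ι).symm
  have h := (hπ.iIndepFun_count _ (C ∘ e) (fun i => hC _)
    (fun i j hij => hd (e.injective.ne hij))).measure_inter_preimage_eq_mul Finset.univ
    (sets := fun i => {(n (e i) : ENNReal)}) (fun i _ => measurableSet_singleton _)
  have he (i : Fin (Fintype.card ι)) :
      (fun ω : Configuration X => ω.toMeasure ((C ∘ e) i)) ⁻¹' {(n (e i) : ENNReal)} =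
        {ω | ω.count (C (e i)) = n (e i)} := by
    ext ω
    simp [toMeasure_eq_count ω (hC (e i)).measurableSet (hC (e i)) subset_rfl]
  simp only [he] at h
  rw [e.prod_comp fun i => π {ω | ω.count (C i) = n i}] at h
  rw [← h]
  congr 1
  ext ω
  simp [e.forall_congr_left]

lemma succ_mul_measure_of_isCompact (hπ : IsPoissonLaw σ π) {ι : Type*} [Fintype ι]
    [DecidableEq ι] {C : ι → Set X}
    (hC : ∀ i, IsCompact (C i)) (hd : Pairwise fun i j => Disjoint (C i) (C j)) (n : ι → ℕ)
    (i₀ : ι) :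
    ((n i₀ + 1 : ℕ) : ENNReal) * π {ω | ∀ i, ω.count (C i) = (n + Pi.single i₀ 1 : ι → ℕ) i} =
      σ (C i₀) * π {ω | ∀ i, ω.count (C i) = n i} := by
  rw [hπ.measure_forall_count_eq hC hd, hπ.measure_forall_count_eq hC hd,
    ← Finset.mul_prod_erase _ _ (Finset.mem_univ i₀), ← Finset.mul_prod_erase _ _
      (Finset.mem_univ i₀), ← mul_assoc, ← mul_assoc]
  congr 1
  · rw [hπ.measure_count_eq (hC _), hπ.measure_count_eq (hC _)]
    simp only [Pi.add_apply, Pi.single_eq_same]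
    rw [succ_mul_poissonMeasure, ENNReal.coe_toNNReal (hC i₀).measure_lt_top.ne]
  · refine Finset.prod_congr rfl fun i hi => ?_
    simp [Pi.single_eq_of_ne (Finset.ne_of_mem_erase hi)]

lemma lintegral_toMeasure_of_isCompact (hπ : IsPoissonLaw σ π) {C : Set X} (hC : IsCompact C) :
    ∫⁻ ω, ω.toMeasure C ∂π = σ C := by
  have h := congrArg (fun μ => ∫⁻ y, y ∂μ) (hπ.map_count C hC)
  beta_reduce at h
  rw [lintegral_map (f := fun y => y) measurable_id (measurable_toMeasure_apply hC.measurableSet),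
    lintegral_map (f := fun y => y) measurable_id .of_discrete,
    lintegral_natCast_poissonMeasure] at h
  rw [h, ENNReal.coe_toNNReal hC.measure_lt_top.ne]

/-- The mean measure of `π` and `σ` agree on compact sets. Inside `K` both are finite, and closed
sets form a generating π-system whose traces on `K` are compact. -/
lemma lintegral_toMeasure (hπ : IsPoissonLaw σ π) {A K : Set X} (hA : MeasurableSet A)
    (hK : IsCompact K) (hAK : A ⊆ K) :
    ∫⁻ ω, ω.toMeasure A ∂π = σ A := by
  have hb (B : Set X) (hB : MeasurableSet B) :
      Measure.bind π toMeasure B = ∫⁻ ω, ω.toMeasure B ∂π :=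
    Measure.bind_apply hB measurable_toMeasure.aemeasurable
  have hbc (B : Set X) (hB : IsCompact B) : Measure.bind π toMeasure B = σ B := by
    rw [hb B hB.measurableSet, hπ.lintegral_toMeasure_of_isCompact hB]
  have : IsFiniteMeasure ((Measure.bind π toMeasure).restrict K) :=
    ⟨by rw [Measure.restrict_apply_univ, hbc K hK]; exact hK.measure_lt_top⟩
  have key : (Measure.bind π toMeasure).restrict K = σ.restrict K := by
    refine ext_of_generate_finite {s : Set X | IsClosed s}
      (by rw [← borel_eq_generateFrom_isClosed]; exact BorelSpace.measurable_eq)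
      isPiSystem_isClosed (fun s hs => ?_) ?_
    · rw [Measure.restrict_apply (IsClosed.measurableSet hs),
        Measure.restrict_apply (IsClosed.measurableSet hs)]
      exact hbc _ (hK.inter_left hs)
    · simp [hbc K hK]
  rw [← hb A hA, ← Measure.restrict_eq_self _ hAK, key, Measure.restrict_eq_self _ hAK]

lemma measure_count_ne_zero_le (hπ : IsPoissonLaw σ π) {A K : Set X} (hA : MeasurableSet A)
    (hK : IsCompact K) (hAK : A ⊆ K) :
    π {ω | ω.count A ≠ 0} ≤ σ A := by
  rw [← hπ.lintegral_toMeasure hA hK hAK]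
  have hm : MeasurableSet {ω : Configuration X | ω.count A ≠ 0} :=
    (measurable_count hA hK hAK) (measurableSet_singleton 0).compl
  rw [← lintegral_indicator_one hm]
  refine lintegral_mono fun ω => ?_
  rw [toMeasure_eq_count ω hA hK hAK, Set.indicator_apply]
  split_ifs with h
  · simpa using Nat.one_le_iff_ne_zero.2 h
  · simp

omit [MeasurableSpace X] [BorelSpace X] in
lemma count_eq_of_count_sdiff_eq_zero {A C K : Set X} (hK : IsCompact K) (hAK : A ⊆ K)
    (hCA : C ⊆ A) (ω : Configuration X) (h : ω.count (A \ C) = 0) : ω.count A = ω.count C := by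
  have hf := finite_inter_of_subset hK (Set.sdiff_subset.trans hAK) ω (A := A \ C)
  have h0 : ω.points ∩ (A \ C) = ∅ := (Set.ncard_eq_zero hf).1 h
  unfold count
  congr 1
  ext x
  constructor
  · intro hx
    refine ⟨hx.1, by_contra fun hxC => ?_⟩
    exact (h0 ▸ ⟨hx.1, hx.2, hxC⟩ : x ∈ (∅ : Set X))
  · exact fun hx => ⟨hx.1, hCA hx.2⟩

lemma exists_isCompact_approx (σ : Measure X) [IsFiniteMeasureOnCompacts σ] {A K : Set X}
    (hA : MeasurableSet A) (hK : IsCompact K)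
    (hAK : A ⊆ K) {ε : ENNReal} (hε : ε ≠ 0) : ∃ C ⊆ A, IsCompact C ∧ σ (A \ C) ≤ ε := by
  have : IsFiniteMeasure (σ.restrict K) := ⟨by simpa using hK.measure_lt_top⟩
  obtain ⟨C, hCA, hC, h⟩ := hA.exists_isClosed_sdiff_lt (μ := σ.restrict K) (measure_ne_top _ _) hε
  refine ⟨C, hCA, hK.of_isClosed_subset hC (hCA.trans hAK), ?_⟩
  rw [Measure.restrict_eq_self _ (Set.sdiff_subset.trans hAK)] at h
  exact h.le

lemma _root_.ENNReal.tendsto_of_le_add_of_le_add {f ε : ℕ → ENNReal} {a : ENNReal} (ha : a ≠ ⊤)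
    (hε : Filter.Tendsto ε .atTop (nhds 0)) (h₁ : ∀ j, f j ≤ a + ε j) (h₂ : ∀ j, a ≤ f j + ε j) :
    Filter.Tendsto f .atTop (nhds a) := by
  refine tendsto_of_tendsto_of_tendsto_of_le_of_le (g := fun j => a - ε j) (h := fun j => a + ε j)
    ?_ ?_ (fun j => tsub_le_iff_right.2 (h₂ j)) h₁
  · simpa using ENNReal.Tendsto.sub (tendsto_const_nhds (x := a)) hε (Or.inl ha)
  · simpa using (tendsto_const_nhds (x := a)).add hε

/-- The law is prescribed on compact sets only, so each `D i` is approximated from inside by compact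
`C j i`. The counts of `D i` and `C j i` differ only if `D i \ C j i` contains a point, which by
Markov's inequality has probability at most `σ (D i \ C j i)`; the recursion passes to the limit. -/
lemma succ_mul_measure (hπ : IsPoissonLaw σ π) {ι : Type*} [Fintype ι]
    [DecidableEq ι] {D : ι → Set X} {K : Set X} (hK : IsCompact K)
    (hD : ∀ i, MeasurableSet (D i)) (hDK : ∀ i, D i ⊆ K)
    (hd : Pairwise fun i j => Disjoint (D i) (D j)) (n : ι → ℕ) (i₀ : ι) :
    ((n i₀ + 1 : ℕ) : ENNReal) * π {ω | ∀ i, ω.count (D i) = (n + Pi.single i₀ 1 : ι → ℕ) i} =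
      σ (D i₀) * π {ω | ∀ i, ω.count (D i) = n i} := by
  have := hπ.isProbabilityMeasure
  have hex (j : ℕ) (i : ι) := exists_isCompact_approx σ (hD i) hK (hDK i)
    (ε := ((j : ENNReal) + 1)⁻¹)
    (by simp)
  choose C hCD hC hCε using hex
  have hε₀ : Filter.Tendsto (fun j : ℕ => ((j : ENNReal) + 1)⁻¹) .atTop (nhds 0) := by
    have := ENNReal.tendsto_inv_nat_nhds_zero.comp (Filter.tendsto_add_atTop_nat 1)
    refine this.congr fun j => ?_
    simp
  have hε : Filter.Tendsto (fun j : ℕ => ∑ i, σ (D i \ C j i)) .atTop (nhds 0) := by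
    have : Filter.Tendsto (fun j : ℕ => ∑ _i : ι, ((j : ENNReal) + 1)⁻¹) .atTop (nhds 0) := by
      simpa using tendsto_finsetSum Finset.univ fun (_ : ι) _ => hε₀
    exact tendsto_of_tendsto_of_tendsto_of_le_of_le tendsto_const_nhds this (fun _ => zero_le)
      fun j => Finset.sum_le_sum fun i _ => hCε j i
  have hbad (j : ℕ) : π (⋃ i, {ω | ω.count (D i \ C j i) ≠ 0}) ≤ ∑ i, σ (D i \ C j i) :=
    (measure_iUnion_fintype_le _ _).trans (Finset.sum_le_sum fun i _ =>
      hπ.measure_count_ne_zero_le ((hD i).diff (hC j i).measurableSet) hK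
        (Set.sdiff_subset.trans (hDK i)))
  have heq (j : ℕ) (ω : Configuration X) (hω : ω ∉ ⋃ i, {ω | ω.count (D i \ C j i) ≠ 0}) (i : ι) :
      ω.count (D i) = ω.count (C j i) := by
    refine count_eq_of_count_sdiff_eq_zero hK (hDK i) (hCD j i) ω ?_
    by_contra h
    exact hω (Set.mem_iUnion.2 ⟨i, h⟩)
  have hlim (m : ι → ℕ) : Filter.Tendsto (fun j => π {ω | ∀ i, ω.count (C j i) = m i}) .atTop
      (nhds (π {ω | ∀ i, ω.count (D i) = m i})) := by
    refine ENNReal.tendsto_of_le_add_of_le_add (measure_ne_top _ _) hε (fun j => ?_) (fun j => ?_)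
    · refine (measure_mono fun ω hω => ?_).trans ((measure_union_le _ _).trans
        (add_le_add_right (hbad j) _))
      by_cases h : ω ∈ ⋃ i, {ω | ω.count (D i \ C j i) ≠ 0}
      · exact Or.inr h
      · exact Or.inl fun i => (heq j ω h i).trans (hω i)
    · refine (measure_mono fun ω hω => ?_).trans ((measure_union_le _ _).trans
        (add_le_add_right (hbad j) _))
      by_cases h : ω ∈ ⋃ i, {ω | ω.count (D i \ C j i) ≠ 0}
      · exact Or.inr h
      · exact Or.inl fun i => (heq j ω h i).symm.trans (hω i)
  have hfin : σ (D i₀) ≠ ⊤ := ((measure_mono (hDK i₀)).trans_lt hK.measure_lt_top).ne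
  have hσ : Filter.Tendsto (fun j => σ (C j i₀)) .atTop (nhds (σ (D i₀))) := by
    refine ENNReal.tendsto_of_le_add_of_le_add hfin hε₀ (fun j => ?_) (fun j => ?_)
    · exact (measure_mono (hCD j i₀)).trans le_self_add
    · refine le_trans ?_ (add_le_add_right (hCε j i₀) _)
      refine (measure_mono ?_).trans (measure_union_le _ _)
      rw [Set.union_sdiff_cancel (hCD j i₀)]
  have hl := ENNReal.Tendsto.const_mul (a := ((n i₀ + 1 : ℕ) : ENNReal)) (hlim (n + Pi.single i₀ 1))
    (Or.inr (ENNReal.natCast_ne_top _))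
  have hr := ENNReal.Tendsto.mul hσ (Or.inr (measure_ne_top _ _)) (hlim n) (Or.inr hfin)
  refine tendsto_nhds_unique hl (hr.congr fun j => ?_)
  exact (hπ.succ_mul_measure_of_isCompact (hC j)
    (fun i i' h => (hd h).mono (hCD j i) (hCD j i')) n i₀).symm

lemma lintegral_count_mul (hπ : IsPoissonLaw σ π) {ι : Type*} [Fintype ι]
    [DecidableEq ι] {D : ι → Set X} {K : Set X} (hK : IsCompact K)
    (hD : ∀ i, MeasurableSet (D i)) (hDK : ∀ i, D i ⊆ K)
    (hd : Pairwise fun i j => Disjoint (D i) (D j)) (f : (ι → ℕ) → ENNReal) (i₀ : ι) :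
    ∫⁻ ω, (ω.count (D i₀) : ENNReal) * f ((fun i => ω.count (D i)) - Pi.single i₀ 1) ∂π =
      σ (D i₀) * ∫⁻ ω, f (fun i => ω.count (D i)) ∂π := by
  have hm : Measurable fun (ω : Configuration X) i => ω.count (D i) :=
    measurable_pi_lambda _ fun i => measurable_count (hD i) hK (hDK i)
  have h₁ := lintegral_map (μ := π)
    (f := fun n : ι → ℕ => (n i₀ : ENNReal) * f (n - Pi.single i₀ 1))
    .of_discrete hm
  have h₂ := lintegral_map (μ := π) (f := f) .of_discrete hm
  rw [← h₁, ← h₂, lintegral_countable', lintegral_countable', ← ENNReal.tsum_mul_left]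
  have hmap (n : ι → ℕ) : (π.map fun ω i => ω.count (D i)) {n} =
      π {ω | ∀ i, ω.count (D i) = n i} := by
    rw [Measure.map_apply hm (measurableSet_singleton n)]
    congr 1
    ext ω
    simp [funext_iff]
  simp only [hmap]
  have hinj : Function.Injective fun n : ι → ℕ => n + Pi.single i₀ 1 :=
    add_left_injective _
  -- Shifting by the unit vector at `i₀` misses only indices with `n i₀ = 0`. These terms vanish
  -- through the factor `n i₀`, so the truncated subtraction is harmless.
  rw [← hinj.tsum_eq]
  · congr 1 with n
    rw [mul_left_comm, ← hπ.succ_mul_measure hK hD hDK hd n i₀]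
    simp only [Pi.add_apply, Pi.single_eq_same, add_tsub_cancel_right]
    ring
  · intro n hn
    have h0 : n i₀ ≠ 0 := by
      intro h
      simp [h] at hn
    refine ⟨n - Pi.single i₀ 1, ?_⟩
    refine tsub_add_cancel_of_le fun i => ?_
    by_cases h : i = i₀
    · subst h
      simpa using Nat.one_le_iff_ne_zero.2 h0
    · simp [Pi.single_eq_of_ne h]

end Compact

end IsPoissonLaw

/-! ### Reduction to atoms and the Mecke formula for finitely many counts -/

namespace Configuration

variable {X : Type*} [TopologicalSpace X]

open scoped Classical in
lemma count_eq_card_filter {A K : Set X} (hK : IsCompact K) (hA : A ⊆ K) (ω : Configuration X) :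
    ω.count A = ((ω.pts hK).filter (· ∈ A)).card := by
  rw [count, ← Set.ncard_coe_finset]
  congr 1
  ext x
  simp only [Set.mem_inter_iff, Finset.coe_filter, mem_pts, Set.mem_ofPred_eq]
  exact ⟨fun h => ⟨⟨h.1, hA h.2⟩, h.2⟩, fun h => ⟨h.1.1, h.2⟩⟩

lemma count_erase_of_mem {A : Set X} (ω : Configuration X) {x : X}
    (hx : x ∈ ω.points) (hxA : x ∈ A) : (ω.erase x).count A = ω.count A - 1 := by
  unfold count
  rw [← Set.ncard_sdiff_singleton_of_mem (show x ∈ ω.points ∩ A from ⟨hx, hxA⟩)]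
  congr 1
  ext y
  simp
  tauto

lemma count_erase_of_notMem {A : Set X} (ω : Configuration X)
    {x : X} (hxA : x ∉ A) : (ω.erase x).count A = ω.count A := by
  unfold count
  congr 1
  ext y
  simp only [points_erase, Set.mem_inter_iff, Set.mem_sdiff, Set.mem_singleton_iff]
  constructor
  · tauto
  · rintro ⟨h₁, h₂⟩
    exact ⟨⟨h₁, fun h => hxA (h ▸ h₂)⟩, h₂⟩

/-- The atoms, in `K`, of the algebra generated by the sets `A i`. -/
def atom {ι : Type*} (K : Set X) (A : ι → Set X) (J : ι → Bool) : Set X :=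
  {x | x ∈ K ∧ ∀ i, x ∈ A i ↔ J i = true}

omit [TopologicalSpace X] in
lemma atom_subset {ι : Type*} (K : Set X) (A : ι → Set X) (J : ι → Bool) : atom K A J ⊆ K :=
  fun _ hx => hx.1

omit [TopologicalSpace X] in
lemma measurableSet_atom [MeasurableSpace X] {ι : Type*} [Countable ι] {K : Set X}
    {A : ι → Set X} (hK : MeasurableSet K) (hA : ∀ i, MeasurableSet (A i)) (J : ι → Bool) :
    MeasurableSet (atom K A J) := by
  have : atom K A J = K ∩ ⋂ i, (if J i = true then A i else (A i)ᶜ) := by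
    ext x
    simp only [atom, Set.mem_ofPred_eq, Set.mem_inter_iff, Set.mem_iInter]
    refine and_congr_right fun _ => forall_congr' fun i => ?_
    split_ifs with h <;> simp [h]
  rw [this]
  refine hK.inter (MeasurableSet.iInter fun i => ?_)
  split_ifs
  exacts [hA i, (hA i).compl]

omit [TopologicalSpace X] in
lemma disjoint_atom {ι : Type*} (K : Set X) (A : ι → Set X) :
    Pairwise fun J J' => Disjoint (atom K A J) (atom K A J') := by
  intro J J' h
  refine Set.disjoint_left.2 fun x hx hx' => h (funext fun i => ?_)
  rw [Bool.eq_iff_iff, ← hx.2 i, hx'.2 i]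

omit [TopologicalSpace X] in
open scoped Classical in
lemma mem_atom_iff {ι : Type*} {K : Set X} (A : ι → Set X) {J : ι → Bool} {x : X} (hx : x ∈ K) :
    x ∈ atom K A J ↔ (fun i => decide (x ∈ A i)) = J := by
  simp only [atom, Set.mem_ofPred_eq, hx, true_and, funext_iff]
  refine forall_congr' fun i => ?_
  cases J i <;> simp

lemma count_eq_sum_atom {ι : Type*} [Fintype ι] [DecidableEq ι] {K : Set X}
    (hK : IsCompact K) {A : ι → Set X} (hA : ∀ i, A i ⊆ K) (i : ι) (ω : Configuration X) :
    ω.count (A i) = ∑ J : ι → Bool with J i = true, ω.count (atom K A J) := by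
  classical
  rw [count_eq_card_filter hK (hA i), Finset.card_eq_sum_card_fiberwise
    (f := fun x i => decide (x ∈ A i)) (t := Finset.univ.filter fun J : ι → Bool => J i = true)]
  · refine Finset.sum_congr rfl fun J hJ => ?_
    rw [count_eq_card_filter hK (atom_subset K A J), Finset.filter_filter]
    congr 1
    refine Finset.filter_congr fun x hx => ?_
    rw [mem_atom_iff A ((mem_pts hK ω x).1 hx).2]
    constructor
    · exact fun h => h.2
    · rintro h
      refine ⟨?_, h⟩
      subst h
      simpa using hJ
  · intro x hx
    simpa using (Finset.mem_filter.1 hx).2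

end Configuration

namespace IsPoissonLaw

open Configuration

variable {X : Type*} [MetricSpace X] [SigmaCompactSpace X] [MeasurableSpace X] [BorelSpace X]
  {σ : Measure X} [IsFiniteMeasureOnCompacts σ] {π : Measure (Configuration X)}

omit [SigmaCompactSpace X] in
open scoped Classical in
/-- The Mecke formula for functions of finitely many counts. -/
lemma lintegral_sum_count_erase (hπ : IsPoissonLaw σ π) {ι : Type*} [Fintype ι] [DecidableEq ι]
    {A : ι → Set X} {K : Set X} (hK : IsCompact K)
    (hA : ∀ i, MeasurableSet (A i)) (hAK : ∀ i, A i ⊆ K) (f : (ι → ℕ) → ENNReal) (i₀ : ι) :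
    ∫⁻ ω, ∑ x ∈ ω.pts hK with x ∈ A i₀, f (fun i => (ω.erase x).count (A i)) ∂π =
      σ (A i₀) * ∫⁻ ω, f (fun i => ω.count (A i)) ∂π := by
  have hD := measurableSet_atom hK.measurableSet hA
  have hDK := atom_subset K A
  have hd := disjoint_atom K A
  -- The sets `A i` may overlap; their counts are sums of counts of disjoint atoms, and `g` is `f`
  -- in terms of the latter.
  let g : ((ι → Bool) → ℕ) → ENNReal := fun m => f fun i => ∑ J : ι → Bool with J i = true, m J
  have hg (ω : Configuration X) :
      f (fun i => ω.count (A i)) = g fun J => ω.count (atom K A J) := by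
    refine congrArg f (funext fun i => count_eq_sum_atom hK hAK i ω)
  -- Points are grouped by the atom containing them: erasing a point of the atom `J` lowers the
  -- count of `J` by one and changes no other atom count.
  have hl (ω : Configuration X) :
      ∑ x ∈ ω.pts hK with x ∈ A i₀, f (fun i => (ω.erase x).count (A i)) =
        ∑ J : ι → Bool with J i₀ = true, (ω.count (atom K A J) : ENNReal) *
          g ((fun J => ω.count (atom K A J)) - Pi.single J 1) := by
    rw [← Finset.sum_fiberwise_of_maps_to (g := fun x i => decide (x ∈ A i))
      (t := Finset.univ.filter fun J : ι → Bool => J i₀ = true)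
      (fun x hx => by simpa using (Finset.mem_filter.1 hx).2)]
    refine Finset.sum_congr rfl fun J hJ => ?_
    rw [count_eq_card_filter hK (hDK J), ← nsmul_eq_mul, ← Finset.sum_const]
    rw [Finset.filter_filter]
    refine Finset.sum_congr (Finset.filter_congr fun x hx => ?_) fun x hx => ?_
    · rw [mem_atom_iff A ((mem_pts hK ω x).1 hx).2]
      constructor
      · exact fun h => h.2
      · rintro h
        refine ⟨?_, h⟩
        subst h
        simpa using hJ
    · obtain ⟨hxω, hxJ⟩ := Finset.mem_filter.1 hx
      rw [hg]
      congr 1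
      ext J'
      simp only [Pi.sub_apply]
      by_cases h : J' = J
      · subst h
        rw [count_erase_of_mem ω ((mem_pts hK ω x).1 hxω).1 hxJ, Pi.single_eq_same]
      · rw [count_erase_of_notMem ω (Set.disjoint_left.1 (hd (Ne.symm h)) hxJ),
          Pi.single_eq_of_ne h, Nat.sub_zero]
  have hm : Measurable fun (ω : Configuration X) J => ω.count (atom K A J) :=
    measurable_pi_lambda _ fun J => measurable_count (hD J) hK (hDK J)
  simp only [hl]
  rw [lintegral_finsetSum]
  · simp only [hπ.lintegral_count_mul hK hD hDK hd g, hg]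
    rw [← Finset.sum_mul]
    congr 1
    -- The atoms with `J i₀ = true` partition `A i₀`.
    rw [← measure_biUnion_finset (fun J _ J' _ h => hd h) (fun J _ => hD J)]
    congr 1
    ext x
    simp only [Set.mem_iUnion, Finset.mem_filter, Finset.mem_univ, true_and, exists_prop]
    constructor
    · rintro ⟨J, hJ, hx⟩
      exact (hx.2 i₀).2 hJ
    · intro hx
      exact ⟨fun i => decide (x ∈ A i), by simpa using hx, (mem_atom_iff A (hAK i₀ hx)).2 rfl⟩
  · intro J _
    have hJ : Measurable fun n : (ι → Bool) → ℕ => (n J : ENNReal) * g (n - Pi.single J 1) :=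
      .of_discrete
    exact hJ.comp hm

end IsPoissonLaw

/-! ### The Mecke formula and moments of counts -/

namespace Configuration

variable {X : Type*} [MetricSpace X] [SigmaCompactSpace X] [MeasurableSpace X] [BorelSpace X]

/-- The Borel sets contained in a compact set. -/
def boundedBorel (X : Type*) [TopologicalSpace X] [MeasurableSpace X] : Set (Set X) :=
  {A | MeasurableSet A ∧ ∃ K, IsCompact K ∧ A ⊆ K}

lemma measurable_of_measurable_count {β : Type*} [MeasurableSpace β] {f : β → Configuration X}
    (hf : ∀ A ∈ boundedBorel X, Measurable fun b => (f b).count A) : Measurable f := by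
  refine measurable_iff_toMeasure.2 fun A hA => ?_
  have : (fun b => (f b).toMeasure A) =
      fun b => ⨆ n, ((f b).count (A ∩ compactCovering X n) : ENNReal) := by
    ext b
    have hmono : Monotone fun n => A ∩ compactCovering X n := fun m n h =>
      Set.inter_subset_inter_right _ (compactCovering_subset X h)
    conv_lhs => rw [← Set.inter_univ A, ← iUnion_compactCovering, Set.inter_iUnion,
      hmono.measure_iUnion]
    congr 1 with n
    exact toMeasure_eq_count _ (hA.inter (isCompact_compactCovering X n).measurableSet)
      (isCompact_compactCovering X n) Set.inter_subset_right
  rw [this]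
  refine Measurable.iSup fun n => Measurable.of_discrete.comp (hf _ ?_)
  exact ⟨hA.inter (isCompact_compactCovering X n).measurableSet, _,
    isCompact_compactCovering X n, Set.inter_subset_right⟩

/-- In this form `piiUnionInter` provides a generating π-system of events that depend on finitely
many counts. -/
lemma iSup_comap_count :
    ⨆ A ∈ boundedBorel X, MeasurableSpace.comap (count A) ⊤ =
      (instMeasurableSpace : MeasurableSpace (Configuration X)) := by
  apply le_antisymm
  · refine iSup₂_le fun A hA => ?_
    obtain ⟨hA, K, hK, hAK⟩ := hA
    exact (measurable_count hA hK hAK).comap_le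
  · have h := @measurable_of_measurable_count X _ _ _ _ _
      (⨆ A ∈ boundedBorel X, MeasurableSpace.comap (count A) ⊤) id fun A hA =>
        (comap_measurable (count A)).mono (le_iSup₂_of_le A hA le_rfl) le_rfl
    simpa using h.comap_le

end Configuration

namespace IsPoissonLaw

open Configuration

variable {X : Type*} [MetricSpace X] [SigmaCompactSpace X] [MeasurableSpace X] [BorelSpace X]
  {σ : Measure X} [IsFiniteMeasureOnCompacts σ] {π : Measure (Configuration X)}

/-- The Mecke formula, as an identity of measures. -/
lemma map_erase_compProd (hπ : IsPoissonLaw σ π) {K : Set X} (hK : IsCompact K) :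
    (π ⊗ₘ restrictKernel hK.measurableSet).map (fun q => (q.1.erase q.2, q.2)) =
      π.prod (σ.restrict K) := by
  classical
  have := hπ.isProbabilityMeasure
  have := isSFiniteKernel_restrictKernel hK hK.measurableSet
  have : IsFiniteMeasure (σ.restrict K) := ⟨by simpa using hK.measure_lt_top⟩
  have hm : Measurable fun q : Configuration X × X => (q.1.erase q.2, q.2) :=
    measurable_erase.prodMk measurable_snd
  symm
  refine Measure.prod_eq_generateFrom
    (C := piiUnionInter (fun A => {s | MeasurableSet[MeasurableSpace.comap (count A) ⊤] s})
      (boundedBorel X)) (D := {s | MeasurableSet s}) ?_ MeasurableSpace.generateFrom_measurableSet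
    ?_ MeasurableSpace.isPiSystem_measurableSet ?_ ?_ ?_
  · exact (generateFrom_piiUnionInter_measurableSet _ _).trans iSup_comap_count
  · exact isPiSystem_piiUnionInter _
      (fun A => @MeasurableSpace.isPiSystem_measurableSet _ (MeasurableSpace.comap (count A) ⊤)) _
  · exact ⟨fun _ => Set.univ, fun _ => ⟨∅, by simp, fun _ => Set.univ, by simp, by simp⟩,
      fun _ => measure_lt_top _ _, Set.iUnion_const _⟩
  · exact ⟨fun _ => Set.univ, fun _ => MeasurableSet.univ,
      fun _ => measure_lt_top _ _, Set.iUnion_const _⟩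
  · rintro s ⟨t, ht, B, hB, rfl⟩ A hA
    have hB' (S : Set X) (hS : S ∈ t) : ∃ V : Set ℕ, B S = count S ⁻¹' V := by
      obtain ⟨V, -, hV⟩ := hB S hS
      exact ⟨V, hV.symm⟩
    choose! V hV using hB'
    have ht' (S : Set X) (hS : S ∈ t) : ∃ L, IsCompact L ∧ S ⊆ L := (ht hS).2
    choose! L hL hSL using ht'
    have hs : MeasurableSet (⋂ S ∈ t, B S) := by
      refine Finset.measurableSet_biInter t fun S hS => ?_
      rw [hV S hS]
      exact measurable_count (ht hS).1 (hL S hS) (hSL S hS) (MeasurableSet.of_discrete)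
    -- The formula for finitely many counts needs one compact set containing all sets involved. The
    -- index `none` marks where the erased point lies, the others describe the event; points of `K'`
    -- outside `A ∩ K` contribute nothing.
    let K' : Set X := K ∪ ⋃ S ∈ t, L S
    have hK' : IsCompact K' := hK.union (t.isCompact_biUnion hL)
    let A' : Option t → Set X := fun o => o.elim (A ∩ K) fun S => S
    have key := hπ.lintegral_sum_count_erase (A := A') hK' ?_ ?_
      (fun n => if ∀ S : t, n (some S) ∈ V S then 1 else 0) none
    · have hind (ω : Configuration X) : (if ∀ S : t, ω.count (A' (some S)) ∈ V S then
          (1 : ENNReal) else 0) = (⋂ S ∈ t, B S).indicator 1 ω := by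
        rw [Set.indicator_apply]
        refine if_congr ?_ rfl rfl
        simp only [Set.mem_iInter, Subtype.forall]
        refine forall₂_congr fun S hS => ?_
        rw [hV S hS]
        rfl
      simp only [hind] at key
      rw [lintegral_indicator_one hs] at key
      rw [Measure.map_apply hm (hs.prod hA), Measure.compProd_apply (hm (hs.prod hA)),
        Measure.restrict_apply hA, mul_comm]
      refine Eq.trans ?_ key
      refine lintegral_congr fun ω => ?_
      have hpre : MeasurableSet (Prod.mk ω ⁻¹' ((fun q : Configuration X × X =>
          (q.1.erase q.2, q.2)) ⁻¹' ((⋂ S ∈ t, B S) ×ˢ A))) :=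
        measurable_prodMk_left (hm (hs.prod hA))
      rw [restrictKernel_apply, ← lintegral_indicator_one hpre,
        lintegral_toMeasure_restrict ω hK hK.measurableSet, Finset.sum_filter]
      have hsub : ω.pts hK ⊆ ω.pts hK' := fun x hx => by
        rw [mem_pts] at hx ⊢
        exact ⟨hx.1, Or.inl hx.2⟩
      rw [← Finset.sum_subset hsub]
      · refine Finset.sum_congr rfl fun x hx => ?_
        have hxK := ((mem_pts hK ω x).1 hx).2
        simp only [Set.indicator_apply, Set.mem_preimage, Set.mem_prod, A', Option.elim,
          Set.mem_inter_iff, hxK, and_true, Pi.one_apply]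
        by_cases h : x ∈ A <;> simp [h]
      · intro x hx hx'
        rw [if_neg]
        intro h
        exact hx' ((mem_pts hK ω x).2 ⟨((mem_pts hK' ω x).1 hx).1, h.2⟩)
    · rintro (_ | S)
      · exact hA.inter hK.measurableSet
      · exact (ht S.2).1
    · rintro (_ | S)
      · exact Set.inter_subset_right.trans Set.subset_union_left
      · exact (hSL S S.2).trans ((Set.subset_biUnion_of_mem (u := L) S.2).trans
          Set.subset_union_right)

lemma lintegral_sum_erase (hπ : IsPoissonLaw σ π) {K : Set X} (hK : IsCompact K)
    {h : Configuration X × X → ENNReal} (hh : Measurable h) :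
    ∫⁻ ω, ∑ x ∈ ω.pts hK, h (ω.erase x, x) ∂π = ∫⁻ q, h q ∂(π.prod (σ.restrict K)) := by
  have := hπ.isProbabilityMeasure
  have := isSFiniteKernel_restrictKernel hK hK.measurableSet
  have hm : Measurable fun q : Configuration X × X => (q.1.erase q.2, q.2) :=
    measurable_erase.prodMk measurable_snd
  have hhm : Measurable fun q : Configuration X × X => h (q.1.erase q.2, q.2) := hh.comp hm
  rw [← hπ.map_erase_compProd hK, lintegral_map hh hm, Measure.lintegral_compProd hhm]
  simp only [restrictKernel_apply, lintegral_toMeasure_restrict _ hK hK.measurableSet]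

lemma integral_sum_erase (hπ : IsPoissonLaw σ π) {K : Set X} (hK : IsCompact K)
    {h : Configuration X × X → ℝ} (hh : Measurable h)
    (hi : Integrable h (π.prod (σ.restrict K))) :
    ∫ ω, ∑ x ∈ ω.pts hK, h (ω.erase x, x) ∂π = ∫ q, h q ∂(π.prod (σ.restrict K)) := by
  have := hπ.isProbabilityMeasure
  have := isSFiniteKernel_restrictKernel hK hK.measurableSet
  have hm : Measurable fun q : Configuration X × X => (q.1.erase q.2, q.2) :=
    measurable_erase.prodMk measurable_snd
  rw [← hπ.map_erase_compProd hK] at hi ⊢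
  have him : Integrable (fun q : Configuration X × X => h (q.1.erase q.2, q.2))
      (π ⊗ₘ restrictKernel hK.measurableSet) := hi.comp_measurable hm
  rw [integral_map hm.aemeasurable hh.aestronglyMeasurable, Measure.integral_compProd him]
  simp only [restrictKernel_apply, integral_toMeasure_restrict _ hK hK.measurableSet]

/-- With `N` the count of `K`, the Mecke formula gives `E[N^(m+1)] = σ(K) E[(N+1)^m]`, the `+ 1`
restoring the erased point. Expanding the right side leaves lower moments. -/
lemma lintegral_count_pow_lt_top (hπ : IsPoissonLaw σ π) {K : Set X} (hK : IsCompact K) (m : ℕ) :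
    ∫⁻ ω, (ω.count K : ENNReal) ^ m ∂π < ⊤ := by
  classical
  have := hπ.isProbabilityMeasure
  have : IsFiniteMeasure (σ.restrict K) := ⟨by simpa using hK.measure_lt_top⟩
  have hc : Measurable fun ω : Configuration X => (ω.count K : ENNReal) :=
    Measurable.of_discrete.comp (measurable_count hK.measurableSet hK subset_rfl)
  induction m using Nat.strong_induction_on with
  | _ m ih =>
    cases m with
    | zero => simp
    | succ m =>
      have hm : Measurable fun q : Configuration X × X => ((q.1.count K : ENNReal) + 1) ^ m :=
        ((hc.comp measurable_fst).add_const 1).pow_const m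
      have h := hπ.lintegral_sum_erase hK hm
      have hl (ω : Configuration X) : ∑ x ∈ ω.pts hK, (((ω.erase x).count K : ENNReal) + 1) ^ m =
          (ω.count K : ENNReal) ^ (m + 1) := by
        rw [pow_succ', count_eq_card hK ω, ← nsmul_eq_mul, ← Finset.sum_const]
        refine Finset.sum_congr rfl fun x hx => ?_
        rw [count_eq_card hK, pts_erase, ← Nat.cast_succ, Nat.succ_eq_add_one,
          Finset.card_erase_add_one hx]
      simp only [hl] at h
      rw [h, lintegral_prod _ hm.aemeasurable]
      simp only [lintegral_const]
      rw [lintegral_mul_const _ ((hc.add_const 1).pow_const m)]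
      refine ENNReal.mul_lt_top ?_ (measure_lt_top _ _)
      simp only [add_pow, one_pow, mul_one]
      rw [lintegral_finsetSum _ fun j _ => (hc.pow_const j).mul_const _]
      refine ENNReal.sum_lt_top.2 fun j hj => ?_
      rw [lintegral_mul_const _ (hc.pow_const j)]
      exact ENNReal.mul_lt_top (ih j (Finset.mem_range.1 hj)) (ENNReal.natCast_lt_top _)

lemma integrable_count_pow (hπ : IsPoissonLaw σ π) {K : Set X} (hK : IsCompact K) (m : ℕ) :
    Integrable (fun ω => (ω.count K : ℝ) ^ m) π := by
  have hc : Measurable fun ω : Configuration X => (ω.count K : ℝ) :=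
    Measurable.of_discrete.comp (measurable_count hK.measurableSet hK subset_rfl)
  refine ⟨(hc.pow_const m).aestronglyMeasurable, ?_⟩
  refine lt_of_eq_of_lt (lintegral_congr fun ω => ?_) (hπ.lintegral_count_pow_lt_top hK m)
  rw [enorm_pow, Real.enorm_natCast]

end IsPoissonLaw

/-! ### Sums over distinct tuples and set partitions -/

section Combinatorics

/-- The sum of `g x` over the injective `k`-tuples `x` of elements of `S`. -/
def injSum {α M : Type*} [DecidableEq α] [AddCommMonoid M] (S : Finset α) {k : ℕ}
    (g : (Fin k → α) → M) : M :=
  ∑ x ∈ Fintype.piFinset fun _ : Fin k => S with Function.Injective x, g x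

section

variable {α M : Type*} [DecidableEq α] [AddCommMonoid M]

lemma injSum_congr {S : Finset α} {k : ℕ} {g g' : (Fin k → α) → M}
    (h : ∀ x, (∀ i, x i ∈ S) → Function.Injective x → g x = g' x) : injSum S g = injSum S g' := by
  refine Finset.sum_congr rfl fun x hx => ?_
  rw [Finset.mem_filter, Fintype.mem_piFinset] at hx
  exact h x hx.1 hx.2

lemma injSum_zero (S : Finset α) (g : (Fin 0 → α) → M) : injSum S g = g Fin.elim0 := by
  have : (Fintype.piFinset fun _ : Fin 0 => S).filter (fun x => Function.Injective x) =
      {Fin.elim0} := by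
    ext x
    simp [Subsingleton.elim x Fin.elim0, Subsingleton.elim default Fin.elim0,
      Function.injective_of_subsingleton]
  rw [injSum, this, Finset.sum_singleton]

lemma injSum_add (S : Finset α) {k : ℕ} (g g' : (Fin k → α) → M) :
    injSum S (fun x => g x + g' x) = injSum S g + injSum S g' :=
  Finset.sum_add_distrib

lemma injSum_sum {ι : Type*} (S : Finset α) {k : ℕ} (t : Finset ι) (g : ι → (Fin k → α) → M) :
    injSum S (fun x => ∑ i ∈ t, g i x) = ∑ i ∈ t, injSum S (g i) :=
  Finset.sum_comm

lemma injSum_mul {R : Type*} [NonUnitalNonAssocSemiring R] (S : Finset α) {k : ℕ}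
    (g : (Fin k → α) → R) (r : R) : injSum S g * r = injSum S fun x => g x * r :=
  Finset.sum_mul _ _ _

lemma injSum_succ_eq_sum_sum (S : Finset α) {k : ℕ} (g : (Fin (k + 1) → α) → M) :
    injSum S g = ∑ y ∈ S, ∑ x ∈ Fintype.piFinset fun _ : Fin k => S,
      if y ∉ Set.range x ∧ Function.Injective x then
        g (Fin.cons y x : Fin (k + 1) → α) else 0 := by
  rw [injSum, Finset.sum_filter, ← Finset.sum_product']
  refine Finset.sum_nbij' (fun x => (x 0, Fin.tail x))
    (fun q => (Fin.cons q.1 q.2 : Fin (k + 1) → α)) ?_ ?_ ?_ ?_ ?_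
  · intro x hx
    rw [Fintype.mem_piFinset] at hx
    exact Finset.mem_product.2 ⟨hx 0, Fintype.mem_piFinset.2 fun i => hx i.succ⟩
  · intro q hq
    rw [Finset.mem_product, Fintype.mem_piFinset] at hq
    exact Fintype.mem_piFinset.2 (Fin.cases hq.1 hq.2)
  · intro x _
    exact Fin.cons_self_tail x
  · intro q _
    simp
  · intro x _
    simp only [Fin.cons_self_tail]
    refine if_congr ?_ rfl rfl
    rw [← Fin.cons_injective_iff, Fin.cons_self_tail]

/-- Choosing the first entry first suits the induction in the Mecke formula, where that point is
erased before the others are chosen. -/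
lemma injSum_succ (S : Finset α) {k : ℕ} (g : (Fin (k + 1) → α) → M) :
    injSum S g = ∑ y ∈ S, injSum (S.erase y) fun x => g (Fin.cons y x : Fin (k + 1) → α) := by
  rw [injSum_succ_eq_sum_sum]
  refine Finset.sum_congr rfl fun y _ => ?_
  rw [injSum, ← Finset.sum_filter]
  refine Finset.sum_congr ?_ fun _ _ => rfl
  ext x
  simp only [Finset.mem_filter, Fintype.mem_piFinset, Finset.mem_erase, Set.mem_range, not_exists,
    forall_and, Ne]
  tauto

/-- Choosing the first entry last suits the power expansion, where one more factor is multiplied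
onto an existing tuple. -/
lemma injSum_succ' (S : Finset α) {k : ℕ} (g : (Fin (k + 1) → α) → M) :
    injSum S g = injSum S fun x : Fin k → α =>
      ∑ y ∈ S with y ∉ Set.range x, g (Fin.cons y x : Fin (k + 1) → α) := by
  rw [injSum_succ_eq_sum_sum, Finset.sum_comm, injSum, Finset.sum_filter]
  refine Finset.sum_congr rfl fun x _ => ?_
  split_ifs with h <;> simp [h, Finset.sum_filter]

lemma abs_injSum_le (S : Finset α) {k : ℕ} (g : (Fin k → α) → ℝ) {C : ℝ} (hC : 0 ≤ C)
    (hg : ∀ x, |g x| ≤ C) :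
    |injSum S g| ≤ C * (S.card : ℝ) ^ k := by
  refine (Finset.abs_sum_le_sum_abs _ _).trans ((Finset.sum_le_card_nsmul _ _ C
    fun x _ => hg x).trans ?_)
  rw [nsmul_eq_mul, mul_comm]
  refine mul_le_mul_of_nonneg_left ?_ hC
  have := Finset.card_filter_le (Fintype.piFinset fun _ : Fin k => S) fun x => Function.Injective x
  rw [Fintype.card_piFinset_const] at this
  exact_mod_cast this

end

/-- Expansion of a power of a finite sum according to the coincidences among the indices. -/
lemma sum_pow_eq_sum_injSum {α R : Type*} [DecidableEq α] [CommSemiring R] (S : Finset α)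
    (a : α → R) (m : ℕ) :
    (∑ y ∈ S, a y) ^ m =
      ∑ P : OrderedFinpartition m, injSum S fun x => ∏ i, a (x i) ^ P.partSize i := by
  induction m with
  | zero =>
    rw [Fintype.sum_subsingleton _ (OrderedFinpartition.atomic 0)]
    rw [pow_zero]
    exact (injSum_zero S fun x : Fin 0 → α => ∏ i, a (x i) ^ 1).symm
  | succ m ih =>
    rw [← (OrderedFinpartition.extendEquiv m).sum_comp, Fintype.sum_sigma, pow_succ, ih,
      Finset.sum_mul]
    refine Finset.sum_congr rfl fun P _ => ?_
    rw [Fintype.sum_option, injSum_mul]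
    -- The extra summation index either takes a value outside the tuple, matching a new singleton
    -- block, or equals a unique `x j`, matching the enlargement of block `j`. These are the two
    -- cases of `OrderedFinpartition.extendEquiv`.
    have hsplit : (injSum S fun x : Fin P.length → α =>
          (∏ i, a (x i) ^ P.partSize i) * ∑ y ∈ S, a y) =
        injSum S fun x : Fin P.length → α =>
          (∑ y ∈ S with y ∉ Set.range x, a y * ∏ i, a (x i) ^ P.partSize i) +
            ∑ j, a (x j) * ∏ i, a (x i) ^ P.partSize i := by
      refine injSum_congr fun x hx hinj => ?_
      rw [← Finset.sum_mul, ← Finset.sum_mul, ← add_mul, mul_comm]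
      congr 1
      rw [← Finset.sum_filter_not_add_sum_filter S (· ∈ Set.range x)]
      congr 1
      rw [← Finset.sum_image (s := Finset.univ) (g := x) (f := a) (fun i _ j _ h => hinj h)]
      refine Finset.sum_congr ?_ fun _ _ => rfl
      ext y
      simp only [Finset.mem_filter, Set.mem_range, Finset.mem_image, Finset.mem_univ, true_and]
      exact ⟨fun h => h.2, fun ⟨i, hi⟩ => ⟨hi ▸ hx i, i, hi⟩⟩
    rw [hsplit, injSum_add, injSum_sum]
    congr 1
    · change _ = injSum S (k := P.length + 1) fun x =>
        ∏ i, a (x i) ^ (Fin.cons 1 P.partSize : Fin (P.length + 1) → ℕ) i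
      rw [injSum_succ']
      simp [Fin.prod_univ_succ]
    · refine Finset.sum_congr rfl fun j _ => ?_
      change _ = injSum S (k := P.length) fun x =>
        ∏ i, a (x i) ^ (Function.update P.partSize j (P.partSize j + 1)) i
      refine injSum_congr fun x _ _ => ?_
      rw [← Finset.mul_prod_erase _ _ (Finset.mem_univ j),
        ← Finset.mul_prod_erase _ (fun i => a (x i) ^ Function.update _ _ _ i) (Finset.mem_univ j),
        Function.update_self, pow_succ', mul_assoc]
      congr 2
      refine Finset.prod_congr rfl fun i hi => ?_
      rw [Function.update_of_ne (Finset.ne_of_mem_erase hi)]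

lemma OrderedFinpartition.sum_partSize {m : ℕ} (P : OrderedFinpartition m) :
    ∑ i, P.partSize i = m := by
  simpa using Fintype.card_congr P.equivSigma

/-- Packing the length and the sizes into a sigma type removes the cast and lets partitions be
sorted into fibres of one map. -/
lemma sigma_eq_iff {k : ℕ} (q : Σ k, Fin k → ℕ) (l : Fin k → ℕ) :
    (∃ h : q.1 = k, ∀ i : Fin k, q.2 (Fin.cast h.symm i) = l i) ↔ q = ⟨k, l⟩ := by
  obtain ⟨j, s⟩ := q
  constructor
  · rintro ⟨h, hs⟩
    dsimp only at h
    subst h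
    exact congrArg (Sigma.mk j) (funext hs)
  · intro h
    cases h
    exact ⟨rfl, fun _ => rfl⟩

lemma numSetPartitions_eq {k m : ℕ} (l : Fin k → ℕ) (hl : ∑ i, l i = m) :
    numSetPartitions l = Nat.card {P : OrderedFinpartition m //
      (⟨P.length, P.partSize⟩ : Σ k, Fin k → ℕ) = ⟨k, l⟩} := by
  subst hl
  refine Nat.card_congr (Equiv.subtypeEquivRight fun P => ?_)
  exact sigma_eq_iff ⟨P.length, P.partSize⟩ l

lemma sum_orderedFinpartition_eq {M : Type*} [CommSemiring M] (m : ℕ)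
    (Φ : (k : ℕ) → (Fin k → ℕ) → M) :
    ∑ P : OrderedFinpartition m, Φ P.length P.partSize =
      ∑ k ∈ Finset.range (m + 1),
        ∑ l ∈ (Finset.Nat.antidiagonalTuple k m).filter (fun l => ∀ i, 1 ≤ l i),
          (numSetPartitions l : M) * Φ k l := by
  classical
  rw [Finset.sum_sigma', ← Finset.sum_fiberwise_of_maps_to
    (g := fun P : OrderedFinpartition m => (⟨P.length, P.partSize⟩ : Σ k, Fin k → ℕ))
    (t := (Finset.range (m + 1)).sigma fun k =>
      (Finset.Nat.antidiagonalTuple k m).filter fun l => ∀ i, 1 ≤ l i)]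
  · refine Finset.sum_congr rfl fun q hq => ?_
    rw [Finset.mem_sigma, Finset.mem_filter, Finset.Nat.mem_antidiagonalTuple] at hq
    rw [numSetPartitions_eq q.2 hq.2.1, Nat.card_eq_fintype_card, Fintype.card_subtype,
      ← nsmul_eq_mul, ← Finset.sum_const]
    refine Finset.sum_congr rfl fun P hP => ?_
    exact congrArg (fun r : Σ k, Fin k → ℕ => Φ r.1 r.2) (Finset.mem_filter.1 hP).2
  · intro P _
    rw [Finset.mem_sigma, Finset.mem_filter, Finset.Nat.mem_antidiagonalTuple, Finset.mem_range]
    exact ⟨Nat.lt_succ_of_le P.length_le, P.sum_partSize, fun i => P.partSize_pos i⟩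

end Combinatorics

/-! ### Product measures under concatenation of tuples -/

section Pi

variable {X : Type*} [MeasurableSpace X] (μ : Measure X) [SigmaFinite μ]

lemma measurable_fin_cons (k : ℕ) :
    Measurable fun q : X × (Fin k → X) => (Fin.cons q.1 q.2 : Fin (k + 1) → X) := by
  refine measurable_pi_lambda _ (Fin.cases ?_ fun i => ?_)
  · simpa using measurable_fst
  · simpa using measurable_snd.eval (a := i)

lemma measurePreserving_fin_cons (k : ℕ) :
    MeasurePreserving (fun q : X × (Fin k → X) => (Fin.cons q.1 q.2 : Fin (k + 1) → X))
      (μ.prod (Measure.pi fun _ => μ)) (Measure.pi fun _ => μ) := by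
  refine ⟨measurable_fin_cons k, (Measure.pi_eq fun s hs => ?_).symm⟩
  rw [Measure.map_apply (measurable_fin_cons k) (.univ_pi hs), Fin.prod_univ_succ, ← Measure.pi_pi,
    ← Measure.prod_prod]
  congr 1
  ext q
  simp [Fin.forall_fin_succ]

lemma measurable_fin_append (k c : ℕ) :
    Measurable fun q : (Fin k → X) × (Fin c → X) => Fin.append q.1 q.2 := by
  refine measurable_pi_lambda _ fun i => Fin.addCases (fun i => ?_) (fun i => ?_) i
  · simpa using measurable_fst.eval (a := i)
  · simpa using measurable_snd.eval (a := i)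

lemma measurePreserving_fin_append (k c : ℕ) :
    MeasurePreserving (fun q : (Fin k → X) × (Fin c → X) => Fin.append q.1 q.2)
      ((Measure.pi fun _ => μ).prod (Measure.pi fun _ => μ)) (Measure.pi fun _ => μ) := by
  refine ⟨measurable_fin_append k c, (Measure.pi_eq fun s hs => ?_).symm⟩
  rw [Measure.map_apply (measurable_fin_append k c) (.univ_pi hs), Fin.prod_univ_add,
    ← Measure.pi_pi, ← Measure.pi_pi, ← Measure.prod_prod]
  congr 1
  ext q
  simp only [Set.mem_preimage, Set.mem_univ_pi, Set.mem_prod]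
  constructor
  · intro h
    exact ⟨fun i => by simpa using h (Fin.castAdd c i), fun i => by simpa using h (Fin.natAdd k i)⟩
  · rintro ⟨h₁, h₂⟩ i
    refine Fin.addCases (fun i => ?_) (fun i => ?_) i
    · simpa using h₁ i
    · simpa using h₂ i

end Pi

lemma integrable_of_measurable_of_abs_le {α : Type*} [MeasurableSpace α] {μ : Measure α}
    [IsFiniteMeasure μ] {f : α → ℝ} (hf : Measurable f) {C : ℝ} (hC : ∀ a, |f a| ≤ C) :
    Integrable f μ :=
  Integrable.of_bound hf.aestronglyMeasurable C (.of_forall hC)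

universe v

/-! ### The Mecke formula for tuples of distinct points -/

namespace Configuration

variable {X : Type v} [MetricSpace X] [SigmaCompactSpace X] [MeasurableSpace X] [BorelSpace X]

omit [SigmaCompactSpace X] [MeasurableSpace X] [BorelSpace X] in
open scoped Classical in
lemma injSum_pts_succ {K : Set X} (hK : IsCompact K) {k : ℕ}
    (G : Configuration X → (Fin (k + 1) → X) → ℝ) (ω : Configuration X) :
    injSum (ω.pts hK) (fun x => G (ω.erasePoints x) x) =
      ∑ y ∈ ω.pts hK, injSum ((ω.erase y).pts hK) fun x => G ((ω.erase y).erasePoints x)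
        (Fin.cons y x) := by
  rw [injSum_succ]
  simp only [erasePoints_cons, pts_erase]

-- The parameter space `P` stores the coordinates already chosen. The induction replaces it by `P ×
-- X`, which is why `P` and `X` share a universe.
open scoped Classical in
lemma measurable_injSum {K : Set X} (hK : IsCompact K) (k : ℕ) {P : Type v} [MeasurableSpace P]
    {G : P → Configuration X → (Fin k → X) → ℝ}
    (hG : Measurable fun q : P × Configuration X × (Fin k → X) => G q.1 q.2.1 q.2.2) :
    Measurable fun q : P × Configuration X =>
      injSum (q.2.pts hK) fun x => G q.1 (q.2.erasePoints x) x := by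
  induction k generalizing P with
  | zero =>
    simp only [injSum_zero, erasePoints_zero]
    exact hG.comp (measurable_fst.prodMk (measurable_snd.prodMk measurable_const))
  | succ k ih =>
    simp only [injSum_pts_succ]
    have := isSFiniteKernel_restrictKernel hK hK.measurableSet
    have h := ih (P := P × X) (G := fun p η x => G p.1 η (Fin.cons p.2 x)) (hG.comp
      ((measurable_fst.comp measurable_fst).prodMk ((measurable_fst.comp measurable_snd).prodMk
        ((measurable_fin_cons k).comp ((measurable_snd.comp measurable_fst).prodMk
          (measurable_snd.comp measurable_snd))))))
    have hm : Measurable fun q : (P × Configuration X) × X =>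
        ((q.1.1, q.2), q.1.2.erase q.2) :=
      ((measurable_fst.comp measurable_fst).prodMk measurable_snd).prodMk
        (measurable_erase.comp ((measurable_snd.comp measurable_fst).prodMk measurable_snd))
    have h' := ((h.comp hm).stronglyMeasurable.integral_kernel_prod_right'
      (κ := Kernel.prodMkLeft P (restrictKernel hK.measurableSet))).measurable
    convert h' using 2 with q
    rw [Kernel.prodMkLeft_apply, restrictKernel_apply,
      integral_toMeasure_restrict _ hK hK.measurableSet]
    rfl

end Configuration

namespace IsPoissonLaw

open Configuration

variable {X : Type v} [MetricSpace X] [SigmaCompactSpace X] [MeasurableSpace X] [BorelSpace X]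
  {σ : Measure X} [IsFiniteMeasureOnCompacts σ] {π : Measure (Configuration X)}

-- There are at most `ω(K)^k` tuples, so a moment of the count dominates.
open scoped Classical in
lemma integrable_injSum (hπ : IsPoissonLaw σ π) {K : Set X} (hK : IsCompact K) {k : ℕ}
    {G : Configuration X → (Fin k → X) → ℝ}
    (hG : Measurable fun q : Configuration X × (Fin k → X) => G q.1 q.2)
    {C : ℝ} (hC0 : 0 ≤ C) (hC : ∀ ω x, |G ω x| ≤ C) :
    Integrable (fun ω => injSum (ω.pts hK) fun x => G (ω.erasePoints x) x) π := by
  have hm : Measurable fun ω : Configuration X =>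
      injSum (ω.pts hK) fun x => G (ω.erasePoints x) x := by
    have hG' : Measurable fun q : PUnit.{v + 1} × Configuration X × (Fin k → X) =>
        G q.2.1 q.2.2 := hG.comp measurable_snd
    have h := measurable_injSum hK k (G := fun _ => G) hG'
    have hι : Measurable fun ω : Configuration X => (PUnit.unit.{v + 1}, ω) :=
      measurable_prodMk_left
    have h' := h.comp hι
    exact h'
  refine ((hπ.integrable_count_pow hK k).const_mul C).mono' hm.aestronglyMeasurable
    (.of_forall fun ω => ?_)
  rw [count_eq_card hK]
  exact abs_injSum_le _ _ hC0 fun x => hC _ _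

open scoped Classical in
/-- The Mecke formula for sums over tuples of distinct points. -/
theorem integral_injSum (hπ : IsPoissonLaw σ π) {K : Set X} (hK : IsCompact K) (k : ℕ)
    {G : Configuration X → (Fin k → X) → ℝ}
    (hG : Measurable fun q : Configuration X × (Fin k → X) => G q.1 q.2)
    {C : ℝ} (hC0 : 0 ≤ C) (hC : ∀ ω x, |G ω x| ≤ C) :
    ∫ ω, injSum (ω.pts hK) (fun x => G (ω.erasePoints x) x) ∂π =
      ∫ ω, ∫ x, G ω x ∂(Measure.pi fun _ => σ.restrict K) ∂π := by
  have := hπ.isProbabilityMeasure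
  have : IsFiniteMeasure (σ.restrict K) := ⟨by simpa using hK.measure_lt_top⟩
  induction k with
  | zero =>
    simp only [injSum_zero, erasePoints_zero]
    refine integral_congr_ae (.of_forall fun ω => ?_)
    have (x : Fin 0 → X) : G ω x = G ω Fin.elim0 := congrArg _ (Subsingleton.elim _ _)
    simp [this, measureReal_def]
  | succ k ih =>
    let h : Configuration X × X → ℝ := fun q =>
      injSum (q.1.pts hK) fun x => G (q.1.erasePoints x) (Fin.cons q.2 x)
    have hGm : Measurable fun q : X × Configuration X × (Fin k → X) =>
        G q.2.1 (Fin.cons q.1 q.2.2) :=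
      hG.comp ((measurable_fst.comp measurable_snd).prodMk ((measurable_fin_cons k).comp
        (measurable_fst.prodMk (measurable_snd.comp measurable_snd))))
    have hm : Measurable h := by
      have h' := (measurable_injSum hK k (G := fun y η x => G η (Fin.cons y x)) hGm).comp
        measurable_swap
      exact h'
    have hi : Integrable h (π.prod (σ.restrict K)) := by
      have hb := ((hπ.integrable_count_pow hK k).const_mul C).comp_fst (σ.restrict K)
      refine hb.mono' hm.aestronglyMeasurable (.of_forall fun q => ?_)
      rw [count_eq_card hK]
      exact abs_injSum_le _ _ hC0 fun x => hC _ _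
    have hl := hπ.integral_sum_erase hK hm hi
    simp only [h] at hl
    simp only [injSum_pts_succ]
    -- After one application of the one-point formula, the point `y` is integrated outermost, so
    -- that the induction hypothesis applies for each fixed `y`; the order is exchanged back at the
    -- end.
    rw [hl, integral_prod_symm _ hi]
    simp only [h]
    have hGy (y : X) : Measurable fun q : Configuration X × (Fin k → X) =>
        G q.1 (Fin.cons y q.2) := by
      have hι : Measurable fun q : Configuration X × (Fin k → X) => (y, q) :=
        measurable_prodMk_left
      exact hGm.comp hι
    have hstep (y : X) := ih (G := fun η x => G η (Fin.cons y x)) (hGy y) fun ω x => hC _ _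
    simp only [hstep]
    have hf : Integrable (fun q : Configuration X × X => ∫ x, G q.1 (Fin.cons q.2 x)
        ∂(Measure.pi fun _ : Fin k => σ.restrict K)) (π.prod (σ.restrict K)) := by
      refine Integrable.integral_prod_left (f := fun q : (Configuration X × X) × (Fin k → X) =>
        G q.1.1 (Fin.cons q.1.2 q.2)) ?_
      refine integrable_of_measurable_of_abs_le (C := C) ?_ fun q => hC _ _
      exact hGm.comp ((measurable_snd.comp measurable_fst).prodMk
        ((measurable_fst.comp measurable_fst).prodMk measurable_snd))
    rw [← integral_integral_swap hf]
    refine integral_congr_ae (.of_forall fun ω => ?_)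
    have hω : Measurable fun x : Fin (k + 1) → X => G ω x :=
      hG.comp (measurable_const.prodMk measurable_id)
    have hmp := measurePreserving_fin_cons (σ.restrict K) k
    beta_reduce
    rw [← hmp.map_eq, integral_map hmp.measurable.aemeasurable hω.aestronglyMeasurable,
      integral_prod]
    exact integrable_of_measurable_of_abs_le (hω.comp hmp.measurable) fun q => hC _ _

end IsPoissonLaw

/-! ### The integrands and the pathwise expansion -/

namespace Configuration

section Points

variable {X : Type*} [TopologicalSpace X]

lemma addPoints_erasePoints {k : ℕ} (ω : Configuration X) {x : Fin k → X}
    (hx : ∀ i, x i ∈ ω.points) : (ω.erasePoints x).addPoints x = ω := by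
  ext y
  simp only [points_addPoints, points_erasePoints, Set.sdiff_union_self]
  rw [Set.union_eq_left.2]
  rintro _ ⟨i, rfl⟩
  exact hx i

lemma addPoints_ne_erasePoints {k : ℕ} (ω : Configuration X) {x : Fin k → X}
    (hx : ∀ i, x i ∈ ω.points) (hinj : Function.Injective x) (i : Fin k) :
    (ω.erasePoints x).addPoints (fun j : {j // j ≠ i} => x j) = ω.erase (x i) := by
  ext y
  simp only [points_addPoints, points_erasePoints, points_erase, Set.mem_union, Set.mem_sdiff,
    Set.mem_range, Subtype.exists, Set.mem_singleton_iff, exists_prop]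
  constructor
  · rintro (⟨h, h'⟩ | ⟨j, hj, rfl⟩)
    · exact ⟨h, fun e => h' ⟨i, e.symm⟩⟩
    · exact ⟨hx j, fun e => hj (hinj e)⟩
  · rintro ⟨h, h'⟩
    by_cases hy : ∃ j, x j = y
    · obtain ⟨j, rfl⟩ := hy
      exact Or.inr ⟨j, fun e => h' (e ▸ rfl), rfl⟩
    · exact Or.inl ⟨h, hy⟩

/-- The integrand of the moment formula after integration of the compensator. -/
noncomputable def reducedIntegrand [MeasurableSpace X] (σ : Measure X) (F : Configuration X → ℝ)
    (u : Configuration X → X → ℝ) {k : ℕ} (l : Fin k → ℕ) (c : ℕ) (ω : Configuration X)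
    (x : Fin k → X) : ℝ :=
  F (ω.addPoints x) * (∏ i, u (ω.addPoints fun j : {j // j ≠ i} => x j) (x i) ^ l i) *
    (∫ y, u (ω.addPoints x) y ∂σ) ^ c

lemma momentIntegrand_append (F : Configuration X → ℝ) (u : Configuration X → X → ℝ) {k : ℕ}
    (l : Fin k → ℕ) (c : ℕ) (ω : Configuration X) (x : Fin k → X) (y : Fin c → X) :
    momentIntegrand F u l c ω (Fin.append x y) =
      F (ω.addPoints x) * (∏ i, u (ω.addPoints fun j : {j // j ≠ i} => x j) (x i) ^ l i) *
        ∏ i, u (ω.addPoints x) (y i) := by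
  rw [momentIntegrand, Fin.prod_univ_add, ← mul_assoc]
  simp only [epsPlus, Fin.append_left, Fin.append_right, pow_one]
  congr 1
  · congr 1
    refine Finset.prod_congr rfl fun i _ => ?_
    have : ω.addPoints (fun j : {j : Fin k // Fin.castAdd c j ≠ Fin.castAdd c i} => x j) =
        ω.addPoints fun j : {j // j ≠ i} => x j := by
      ext z
      simp
    rw [this]
  · refine Finset.prod_congr rfl fun i _ => ?_
    have : ω.addPoints (fun j : {j : Fin k // Fin.castAdd c j ≠ Fin.natAdd k i} => x j) =
        ω.addPoints x := by
      have h (j : Fin k) : Fin.castAdd c j ≠ Fin.natAdd k i := by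
        simp only [Ne, Fin.ext_iff, Fin.val_castAdd, Fin.val_natAdd]
        omega
      ext z
      simp [h]
    rw [this]

/-- Every exponent is at least one, so a coordinate outside `K` kills its factor. This confines the
integrals to a product of copies of `K`. -/
lemma momentIntegrand_eq_zero {F : Configuration X → ℝ} {u : Configuration X → X → ℝ} {K : Set X}
    (huK : ∀ ω x, x ∉ K → u ω x = 0) {k : ℕ} {l : Fin k → ℕ} (hl : ∀ i, 1 ≤ l i) (c : ℕ)
    (ω : Configuration X) {s : Fin (k + c) → X} (hs : s ∉ Set.univ.pi fun _ => K) :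
    momentIntegrand F u l c ω s = 0 := by
  simp only [Set.mem_univ_pi, not_forall] at hs
  obtain ⟨p, hp⟩ := hs
  refine mul_eq_zero_of_right _ (Finset.prod_eq_zero (Finset.mem_univ p) ?_)
  simp only [epsPlus, huK _ _ hp]
  refine zero_pow ?_
  refine Fin.addCases (fun i => ?_) (fun i => ?_) p
  · simpa using Nat.one_le_iff_ne_zero.1 (hl i)
  · simp

-- This puts the expanded power into the form `G (ω \ x, x)` demanded by the Mecke formula, using
-- that the entries of `x` are distinct points of `ω`.
open scoped Classical in
lemma pow_mul_pow_mul_eq_sum_injSum [MeasurableSpace X] {K : Set X} (hK : IsCompact K)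
    (σ : Measure X) (F : Configuration X → ℝ) (u : Configuration X → X → ℝ) (m c : ℕ)
    (ω : Configuration X) :
    (∑ x ∈ ω.pts hK, u (ω.erase x) x) ^ m * (F ω * (∫ y, u ω y ∂σ) ^ c) =
      ∑ P : OrderedFinpartition m, injSum (ω.pts hK) fun x =>
        reducedIntegrand σ F u P.partSize c (ω.erasePoints x) x := by
  rw [sum_pow_eq_sum_injSum, Finset.sum_mul]
  refine Finset.sum_congr rfl fun P _ => ?_
  rw [injSum_mul]
  refine injSum_congr fun x hx hinj => ?_
  have hx' (i) : x i ∈ ω.points := ((mem_pts hK ω _).1 (hx i)).1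
  simp only [reducedIntegrand, addPoints_erasePoints ω hx', addPoints_ne_erasePoints ω hx' hinj]
  ring

end Points

section Metric

variable {X : Type*} [MetricSpace X] [MeasurableSpace X]

lemma skorohod_eq [BorelSpace X] {K : Set X} (hK : IsCompact K) {σ : Measure X}
    {u : Configuration X → X → ℝ}
    (huK : ∀ ω x, x ∉ K → u ω x = 0) (ω : Configuration X) :
    skorohod σ u ω = (∑ x ∈ ω.pts hK, u (ω.erase x) x) - ∫ x, u ω x ∂(σ.restrict K) := by
  rw [skorohod, setIntegral_eq_integral_of_forall_compl_eq_zero (huK ω),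
    ← integral_toMeasure_restrict ω hK hK.measurableSet,
    setIntegral_eq_integral_of_forall_compl_eq_zero fun x => huK (ω.erase x) x]

lemma exists_abs_reducedIntegrand_le (σ : Measure X) [IsFiniteMeasure σ] {F : Configuration X → ℝ}
    {u : Configuration X → X → ℝ} (hFb : ∃ C : ℝ, ∀ ω, |F ω| ≤ C)
    (hub : ∃ C : ℝ, ∀ ω x, |u ω x| ≤ C) {k : ℕ} (l : Fin k → ℕ) (c : ℕ) :
    ∃ C, 0 ≤ C ∧ ∀ ω x, |reducedIntegrand σ F u l c ω x| ≤ C := by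
  obtain ⟨A, hA0, hA⟩ : ∃ A, 0 ≤ A ∧ ∀ ω, |F ω| ≤ A :=
    hFb.imp' (|·|) fun A h => ⟨abs_nonneg A, fun ω => (h ω).trans (le_abs_self A)⟩
  obtain ⟨B, hB0, hB⟩ : ∃ B, 0 ≤ B ∧ ∀ ω x, |u ω x| ≤ B :=
    hub.imp' (|·|) fun B h => ⟨abs_nonneg B, fun ω x => (h ω x).trans (le_abs_self B)⟩
  refine ⟨A * (∏ i, B ^ l i) * (B * σ.real Set.univ) ^ c, by positivity, fun ω x => ?_⟩
  rw [reducedIntegrand, abs_mul, abs_mul, Finset.abs_prod, abs_pow]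
  gcongr
  · exact hA _
  · rw [abs_pow]
    gcongr
    exact hB _ _
  · exact norm_integral_le_of_norm_le_const (μ := σ) (f := fun y => u (ω.addPoints x) y)
      (.of_forall fun y => hB _ y)

omit [MeasurableSpace X] in
lemma exists_abs_momentIntegrand_le {F : Configuration X → ℝ}
    {u : Configuration X → X → ℝ} (hFb : ∃ C : ℝ, ∀ ω, |F ω| ≤ C)
    (hub : ∃ C : ℝ, ∀ ω x, |u ω x| ≤ C) {k : ℕ} (l : Fin k → ℕ) (c : ℕ) :
    ∃ C, ∀ ω s, |momentIntegrand F u l c ω s| ≤ C := by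
  obtain ⟨A, hA0, hA⟩ : ∃ A, 0 ≤ A ∧ ∀ ω, |F ω| ≤ A :=
    hFb.imp' (|·|) fun A h => ⟨abs_nonneg A, fun ω => (h ω).trans (le_abs_self A)⟩
  obtain ⟨B, hB0, hB⟩ : ∃ B, 0 ≤ B ∧ ∀ ω x, |u ω x| ≤ B :=
    hub.imp' (|·|) fun B h => ⟨abs_nonneg B, fun ω x => (h ω x).trans (le_abs_self B)⟩
  refine ⟨A * ∏ p : Fin (k + c), B ^ Fin.append l (fun _ : Fin c => 1) p, fun ω s => ?_⟩
  rw [momentIntegrand, abs_mul, Finset.abs_prod]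
  gcongr with p
  · exact hA _
  · rw [epsPlus, abs_pow]
    gcongr
    exact hB _ _

variable [SigmaCompactSpace X] [BorelSpace X]

lemma measurable_addPoints_comp {ι κ : Type*} [Finite ι] (e : ι → κ) :
    Measurable fun q : Configuration X × (κ → X) => q.1.addPoints fun j => q.2 (e j) :=
  measurable_addPoints.comp (measurable_fst.prodMk
    (measurable_pi_lambda _ fun j => (measurable_pi_apply (e j)).comp measurable_snd))

variable {F : Configuration X → ℝ} {u : Configuration X → X → ℝ}

lemma measurable_apply_addPoints_comp
    (hu : Measurable fun q : Configuration X × X => u q.1 q.2) {ι κ : Type*} [Finite ι]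
    (e : ι → κ) (p : κ) :
    Measurable fun q : Configuration X × (κ → X) =>
      u (q.1.addPoints fun j => q.2 (e j)) (q.2 p) :=
  hu.comp ((measurable_addPoints_comp e).prodMk ((measurable_pi_apply p).comp measurable_snd))

lemma measurable_momentIntegrand (hF : Measurable F)
    (hu : Measurable fun q : Configuration X × X => u q.1 q.2) {k : ℕ} (l : Fin k → ℕ) (c : ℕ) :
    Measurable fun q : Configuration X × (Fin (k + c) → X) => momentIntegrand F u l c q.1 q.2 := by
  refine (hF.comp (measurable_addPoints_comp fun j : Fin k => Fin.castAdd c j)).mul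
    (Finset.measurable_prod _ fun p _ => ?_)
  exact (measurable_apply_addPoints_comp hu (fun j : {j : Fin k // Fin.castAdd c j ≠ p} =>
    Fin.castAdd c (j : Fin k)) p).pow_const _

lemma measurable_reducedIntegrand (σ : Measure X) [SFinite σ] (hF : Measurable F)
    (hu : Measurable fun q : Configuration X × X => u q.1 q.2) {k : ℕ} (l : Fin k → ℕ) (c : ℕ) :
    Measurable fun q : Configuration X × (Fin k → X) => reducedIntegrand σ F u l c q.1 q.2 := by
  have hB : Measurable fun ω : Configuration X => ∫ y, u ω y ∂σ :=
    hu.stronglyMeasurable.integral_prod_right'.measurable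
  refine ((hF.comp measurable_addPoints).mul (Finset.measurable_prod _ fun i _ => ?_)).mul
    ((hB.comp measurable_addPoints).pow_const c)
  exact (measurable_apply_addPoints_comp hu (fun j : {j // j ≠ i} => (j : Fin k)) i).pow_const _

variable {K : Set X} {σ : Measure X} [SigmaFinite σ]

/-- The last `c` coordinates enter only through a product of values of `u` at the same configuration
`ω ∪ x`, so Fubini turns their integral into a `c`-th power. -/
lemma integral_momentIntegrand [IsFiniteMeasure (σ.restrict K)]
    (hF : Measurable F) (hFb : ∃ C : ℝ, ∀ ω, |F ω| ≤ C)
    (hu : Measurable fun q : Configuration X × X => u q.1 q.2)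
    (hub : ∃ C : ℝ, ∀ ω x, |u ω x| ≤ C) (huK : ∀ ω x, x ∉ K → u ω x = 0) {k : ℕ}
    {l : Fin k → ℕ} (hl : ∀ i, 1 ≤ l i) (c : ℕ) (ω : Configuration X) :
    ∫ s : Fin (k + c) → X, momentIntegrand F u l c ω s ∂(Measure.pi fun _ => σ) =
      ∫ x, reducedIntegrand (σ.restrict K) F u l c ω x ∂(Measure.pi fun _ => σ.restrict K) := by
  obtain ⟨C, hC⟩ := exists_abs_momentIntegrand_le hFb hub l c
  have hm : Measurable fun s : Fin (k + c) → X => momentIntegrand F u l c ω s := by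
    have h := (measurable_momentIntegrand hF hu l c).comp
      (measurable_prodMk_left (x := ω))
    exact h
  have hmp := measurePreserving_fin_append (σ.restrict K) k c
  rw [← setIntegral_eq_integral_of_forall_compl_eq_zero (s := Set.univ.pi fun _ => K)
    fun s hs => momentIntegrand_eq_zero huK hl c ω hs, Measure.restrict_pi_pi, ← hmp.map_eq,
    integral_map hmp.measurable.aemeasurable hm.aestronglyMeasurable, integral_prod]
  · refine integral_congr_ae (.of_forall fun x => ?_)
    simp only [momentIntegrand_append]
    rw [integral_const_mul, integral_fintype_prod_eq_pow, Fintype.card_fin]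
    rfl
  · exact integrable_of_measurable_of_abs_le (hm.comp hmp.measurable) fun q => hC _ _

lemma integrable_momentIntegrand {π : Measure (Configuration X)} [IsFiniteMeasure π]
    [IsFiniteMeasure (σ.restrict K)]
    (hF : Measurable F) (hFb : ∃ C : ℝ, ∀ ω, |F ω| ≤ C)
    (hu : Measurable fun q : Configuration X × X => u q.1 q.2)
    (hub : ∃ C : ℝ, ∀ ω x, |u ω x| ≤ C) (huK : ∀ ω x, x ∉ K → u ω x = 0) {k : ℕ}
    {l : Fin k → ℕ} (hl : ∀ i, 1 ≤ l i) (c : ℕ) :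
    Integrable (fun q : Configuration X × (Fin (k + c) → X) => momentIntegrand F u l c q.1 q.2)
      (π.prod (Measure.pi fun _ => σ)) := by
  obtain ⟨C, hC⟩ := exists_abs_momentIntegrand_le hFb hub l c
  rw [← integrableOn_iff_integrable_of_support_subset
    (s := Set.univ ×ˢ Set.univ.pi fun _ => K)]
  · rw [IntegrableOn, ← Measure.prod_restrict, Measure.restrict_univ, Measure.restrict_pi_pi]
    exact integrable_of_measurable_of_abs_le (measurable_momentIntegrand hF hu l c)
      fun q => hC _ _
  · intro q hq
    refine ⟨Set.mem_univ _, ?_⟩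
    by_contra h
    exact hq (momentIntegrand_eq_zero huK hl c q.1 h)

end Metric

end Configuration

/-! ### The moment formula -/

open Configuration in
theorem proposition2p1 {X : Type*} [MetricSpace X] [SigmaCompactSpace X]
    [MeasurableSpace X] [BorelSpace X]
    (σ : Measure X) [SigmaFinite σ] [NullSingletonClass σ] [IsFiniteMeasureOnCompacts σ]
    (π : Measure (Configuration X)) (hπ : IsPoissonLaw σ π)
    (F : Configuration X → ℝ) (hF : Measurable F) (hFb : ∃ C : ℝ, ∀ ω, |F ω| ≤ C)
    (u : Configuration X → X → ℝ)
    (hu : Measurable (fun q : Configuration X × X => u q.1 q.2))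
    (hub : ∃ C : ℝ, ∀ ω x, |u ω x| ≤ C)
    (huK : ∃ K : Set X, IsCompact K ∧ ∀ ω x, x ∉ K → u ω x = 0)
    (n : ℕ) :
    Integrable (fun ω => skorohod σ u ω ^ n * F ω) π ∧
    (∀ c ∈ Finset.range (n + 1), ∀ k ∈ Finset.range (n - c + 1),
      ∀ l ∈ (Finset.Nat.antidiagonalTuple k (n - c)).filter (fun l => ∀ i, 1 ≤ l i),
        Integrable (fun q : Configuration X × (Fin (k + c) → X) =>
            momentIntegrand F u l c q.1 q.2)
          (π.prod (Measure.pi fun _ : Fin (k + c) => σ))) ∧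
    ∫ ω, skorohod σ u ω ^ n * F ω ∂π =
      ∑ c ∈ Finset.range (n + 1), (-1 : ℝ) ^ c * (n.choose c : ℝ) *
        ∑ k ∈ Finset.range (n - c + 1),
          ∑ l ∈ (Finset.Nat.antidiagonalTuple k (n - c)).filter (fun l => ∀ i, 1 ≤ l i),
            (numSetPartitions l : ℝ) *
              ∫ ω, (∫ s : Fin (k + c) → X, momentIntegrand F u l c ω s
                ∂(Measure.pi fun _ : Fin (k + c) => σ)) ∂π := by
  classical
  obtain ⟨K, hK, huK⟩ := huK
  have := hπ.isProbabilityMeasure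
  have : IsFiniteMeasure (σ.restrict K) := ⟨by simpa using hK.measure_lt_top⟩
  have hexp (ω : Configuration X) : skorohod σ u ω ^ n * F ω =
      ∑ c ∈ Finset.range (n + 1), (-1 : ℝ) ^ c * (n.choose c : ℝ) *
        ∑ P : OrderedFinpartition (n - c), injSum (ω.pts hK) fun x =>
          reducedIntegrand (σ.restrict K) F u P.partSize c (ω.erasePoints x) x := by
    -- The compensator is put first so that the binomial index `c` is its exponent.
    rw [skorohod_eq hK huK, sub_eq_neg_add, add_pow, Finset.sum_mul]
    refine Finset.sum_congr rfl fun c _ => ?_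
    rw [← pow_mul_pow_mul_eq_sum_injSum hK, neg_pow]
    ring
  have hi (c : ℕ) (P : OrderedFinpartition (n - c)) : Integrable (fun ω => injSum (ω.pts hK)
      fun x => reducedIntegrand (σ.restrict K) F u P.partSize c (ω.erasePoints x) x) π := by
    obtain ⟨C, hC0, hC⟩ :=
      exists_abs_reducedIntegrand_le (σ.restrict K) hFb hub P.partSize c
    exact hπ.integrable_injSum hK (measurable_reducedIntegrand _ hF hu P.partSize c) hC0 hC
  have hi' (c : ℕ) : Integrable (fun ω => (-1 : ℝ) ^ c * (n.choose c : ℝ) *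
      ∑ P : OrderedFinpartition (n - c), injSum (ω.pts hK) fun x =>
        reducedIntegrand (σ.restrict K) F u P.partSize c (ω.erasePoints x) x) π :=
    (integrable_finsetSum _ fun P _ => hi c P).const_mul _
  simp only [hexp]
  refine ⟨integrable_finsetSum _ fun c _ => hi' c, fun c _ k _ l hl => ?_, ?_⟩
  · exact integrable_momentIntegrand hF hFb hu hub huK (Finset.mem_filter.1 hl).2 c
  · rw [integral_finsetSum _ fun c _ => hi' c]
    refine Finset.sum_congr rfl fun c _ => ?_
    rw [integral_const_mul, integral_finsetSum _ fun P _ => hi c P]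
    congr 1
    -- Each partition contributes through its length and block sizes alone, so the sum can then be
    -- regrouped by these.
    have hP (P : OrderedFinpartition (n - c)) :
        ∫ ω, injSum (ω.pts hK) (fun x =>
          reducedIntegrand (σ.restrict K) F u P.partSize c (ω.erasePoints x) x) ∂π =
        ∫ ω, (∫ s : Fin (P.length + c) → X, momentIntegrand F u P.partSize c ω s
          ∂(Measure.pi fun _ => σ)) ∂π := by
      obtain ⟨C, hC0, hC⟩ :=
        exists_abs_reducedIntegrand_le (σ.restrict K) hFb hub P.partSize c
      rw [hπ.integral_injSum hK _ (measurable_reducedIntegrand _ hF hu P.partSize c) hC0 hC]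
      refine integral_congr_ae (.of_forall fun ω => ?_)
      exact (integral_momentIntegrand hF hFb hu hub huK (fun i => P.partSize_pos i) c ω).symm
    simp only [hP]
    exact sum_orderedFinpartition_eq (n - c) fun k l =>
      ∫ ω, (∫ s : Fin (k + c) → X, momentIntegrand F u l c ω s ∂(Measure.pi fun _ => σ)) ∂π
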